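/- **Theorem (2D Fourier inversion theorem).** For real $a_1<b_1$, $a_2<b_2$, a function $f:\mathbb R^2\to\mathbb R$ is called of bounded variation in Hardy's sense on the rectangle $[a_1,b_1]\times[a_2,b_2]$ if 1. the sums $\sum_{i=0}^{m-1}\sum_{j=0}^{n-1}|f(s_{i+1},t_{j+1})-f(s_{i+1},t_j)-f(s_i,t_{j+1})+f(s_i,t_j)|$ are bounded by a constant independent of the subdivisions $a_1=s_0<\dots<s_m=b_1$ and $a_2=t_0<\dots<t_n=b_2$, and 2. $f(\tilde s,\cdot)$ is of bounded variation on $[a_2,b_2]$ for at least one $\tilde s\in[a_1,b_1]$, and $f(\cdot,\tilde t)$ is of bounded variation on $[a_1,b_1]$ for at least one $\tilde t\in[a_2,b_2]$. For $(x_0,y_0)\in\mathbb R^2$ and $\varepsilon_1,\varepsilon_2>0$, the cross-neighborhood of $(x_0,y_0)$ with half-widths $\varepsilon_1,\varepsilon_2$ is the set of points $(s,t)$ with $|s-x_0|\le\varepsilon_1$ or $|t-y_0|\le\varepsilon_2$ (or both). A function is of bounded variation in Hardy's sense in it if it is so on every compact rectangle $[a_1,b_1]\times[a_2,b_2]$,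 $a_1<b_1$, $a_2<b_2$, contained in it. Put $$\tilde f(s,t)=f(x_0-s,y_0-t)+f(x_0+s,y_0+t)+f(x_0-s,y_0+t)+f(x_0+s,y_0-t).$$ The function $f$ belongs to the class $\mathbf{LC}$ in this cross-neighborhood if there are $a,b\in\mathbb R$ such that $\tilde f(a,\cdot)$ and $\tilde f(\cdot,b)$ are integrable on $\mathbb R$ and $$\int_{\varepsilon_2}^{\infty}\int_0^{\varepsilon_1}\left|\frac{\tilde f(s,t)-\tilde f(a,t)}{s}\right|ds\,dt<\infty,\qquad \int_{\varepsilon_1}^{\infty}\int_0^{\varepsilon_2}\left|\frac{\tilde f(s,t)-\tilde f(s,b)}{t}\right|dt\,ds<\infty.$$ Let $f:\mathbb R^2\to\mathbb R$ be integrable, and suppose that, in some cross-neighborhood of $(x_0,y_0)$ (the same one for both conditions), $f$ is of bounded variation in Hardy's sense and belongs to $\mathbf{LC}$. Then the four corner limits $f(x_0\pm0,y_0\pm0)=\lim_{h\to0^+,\,k\to0^+}f(x_0\pm h,y_0\pm k)$, with all four choices of signs, exist and are finite. Moreover, with $$F(u,v)=\int_{\mathbb R^2}f(s,t)e^{-ius}e^{-ivt}\,ds\,dt$$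 and $$\eta(x_0,y_0)=\frac{f(x_0+0,y_0+0)+f(x_0+0,y_0-0)+f(x_0-0,y_0+0)+f(x_0-0,y_0-0)}{4},$$ one has $$\lim_{M,N\to\infty}\frac1{4\pi^2}\int_{-N}^{N}\int_{-M}^{M}F(u,v)e^{iux_0}e^{ivy_0}\,du\,dv=\eta(x_0,y_0),$$ where $M$ and $N$ tend to infinity independently. If $f$ is continuous at $(x_0,y_0)$, then $\eta(x_0,y_0)=f(x_0,y_0)$. -/

import Mathlib

open Set Filter Topology MeasureTheory

noncomputable section

namespace FourierInversion2D

/-- The mixed second difference of `f` over the cell with lower left corner `(s₀, t₀)` and upper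
right corner `(s₁, t₁)`. -/
def mixedDiff (f : ℝ × ℝ → ℝ) (s₀ s₁ t₀ t₁ : ℝ) : ℝ :=
  f (s₁, t₁) - f (s₁, t₀) - f (s₀, t₁) + f (s₀, t₀)

/-- `s 0 < s 1 < ⋯ < s m` is a subdivision of `[a, b]` (values of `s` beyond `m` are irrelevant). -/
def IsNet (a b : ℝ) (m : ℕ) (s : ℕ → ℝ) : Prop :=
  s 0 = a ∧ s m = b ∧ ∀ i < m, s i < s (i + 1)

/-- `f` is of bounded variation in the sense of Hardy on the rectangle `[a₁, b₁] × [a₂, b₂]`. -/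
structure IsBVOnRect (f : ℝ × ℝ → ℝ) (a₁ b₁ a₂ b₂ : ℝ) : Prop where
  bounded_sums : ∃ C : ℝ, ∀ (m n : ℕ) (s t : ℕ → ℝ), IsNet a₁ b₁ m s → IsNet a₂ b₂ n t →
    ∑ i ∈ Finset.range m, ∑ j ∈ Finset.range n,
      |mixedDiff f (s i) (s (i + 1)) (t j) (t (j + 1))| ≤ C
  vertical_section : ∃ s ∈ Icc a₁ b₁, BoundedVariationOn (fun t => f (s, t)) (Icc a₂ b₂)
  horizontal_section : ∃ t ∈ Icc a₂ b₂, BoundedVariationOn (fun s => f (s, t)) (Icc a₁ b₁)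

/-- The (unbounded, closed) cross-neighborhood of `(x₀, y₀)` with half-widths `ε₁` and `ε₂`. -/
def cross (x₀ y₀ ε₁ ε₂ : ℝ) : Set (ℝ × ℝ) :=
  {p | |p.1 - x₀| ≤ ε₁ ∨ |p.2 - y₀| ≤ ε₂}

/-- `f` is of bounded variation in the sense of Hardy in the set `S`: it is so on every
nondegenerate compact rectangle contained in `S`. No bound uniform in the rectangle is asked. -/
def IsBVIn (f : ℝ × ℝ → ℝ) (S : Set (ℝ × ℝ)) : Prop :=
  ∀ a₁ b₁ a₂ b₂ : ℝ, a₁ < b₁ → a₂ < b₂ → Icc a₁ b₁ ×ˢ Icc a₂ b₂ ⊆ S → IsBVOnRect f a₁ b₁ a₂ b₂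

/-- The sum of the values of `f` at the four points `(x₀ ± s, y₀ ± t)`. -/
def symmSum (f : ℝ × ℝ → ℝ) (x₀ y₀ s t : ℝ) : ℝ :=
  f (x₀ - s, y₀ - t) + f (x₀ + s, y₀ + t) + f (x₀ - s, y₀ + t) + f (x₀ + s, y₀ - t)

/-- The class **LC** in the cross-neighborhood of `(x₀, y₀)` with half-widths `ε₁` and `ε₂`. -/
def IsLC (f : ℝ × ℝ → ℝ) (x₀ y₀ ε₁ ε₂ : ℝ) : Prop :=
  (∃ a : ℝ, Integrable (fun t => symmSum f x₀ y₀ a t) ∧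
    ∫⁻ t in Ioi ε₂, ∫⁻ s in Ioc 0 ε₁,
      ENNReal.ofReal |(symmSum f x₀ y₀ s t - symmSum f x₀ y₀ a t) / s| < ⊤) ∧
  (∃ b : ℝ, Integrable (fun s => symmSum f x₀ y₀ s b) ∧
    ∫⁻ s in Ioi ε₁, ∫⁻ t in Ioc 0 ε₂,
      ENNReal.ofReal |(symmSum f x₀ y₀ s t - symmSum f x₀ y₀ s b) / t| < ⊤)

/-- The two-dimensional Fourier transform `F(u,v) = ∫ f(s,t) e^{-ius} e^{-ivt} ds dt`. -/
def fourier2 (f : ℝ × ℝ → ℝ) (u v : ℝ) : ℂ :=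
  ∫ p : ℝ × ℝ, (f p : ℂ) * Complex.exp (-Complex.I * u * p.1) * Complex.exp (-Complex.I * v * p.2)

/-- The rectangular partial inverse Fourier integral at `(x₀, y₀)` over `|u| ≤ M`, `|v| ≤ N`. -/
def partialInverse (f : ℝ × ℝ → ℝ) (x₀ y₀ M N : ℝ) : ℂ :=
  1 / (4 * (Real.pi : ℂ) ^ 2) * ∫ v in (-N)..N, ∫ u in (-M)..M,
    fourier2 f u v * Complex.exp (Complex.I * u * x₀) * Complex.exp (Complex.I * v * y₀)

end FourierInversion2D

end

/-!
Folding the plane along the lines `s = x₀` and `t = y₀` turns the partial inverse Fourier integral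
into `π⁻²` times the integral over the open quadrant of `symmSum f x₀ y₀ s t` against the product
of the kernels `sin (M s) / s` and `sin (N t) / t`. The quadrant is cut at `s = ε₁` and at `t = ε₂`.

* On the unbounded pieces the integral tends to zero. Away from both axes this is a
  Riemann–Lebesgue lemma in two frequencies. On a strip along an axis, **LC** says that
  after the subtraction of one fixed section the quotient by the small variable is integrable, so
  that the Riemann–Lebesgue lemma applies again; the subtracted term is the product of a bounded
  sine integral and a one-dimensional Riemann–Lebesgue integral (`tendsto_setIntegral_strip`).

* On the rectangle at the corner, bounded variation in the sense of Hardy is used in the form of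
  `HardyControl`: there is a monotone function `R` such that the section at `s'` differs from the
  section at `s` by at most `R s' - R s`, both in variation and in sup norm. It is obtained by
  regarding the two-dimensional variation as the one-dimensional variation of the map
  `s ↦ f (s, ·)` into the space of sections, with the variation of the difference as distance. It
  gives the corner limits, and it makes the inner Dirichlet integrals functions of `s` whose
  variation is controlled by a multiple of `R` uniformly in the inner frequency. A Jordan theorem
  for such families (`tendsto_integral_mul_sinc`), applied first in `t` and then in `s`, yields the
  corner limit times `(π / 2) ^ 2`.

The one-dimensional theorem rests on the Dirichlet integral (`tendsto_sinIntegral`) and on a second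
mean value inequality (`VariesBy.integral_mul`), which the layer cake formula reduces to integrals
of the kernel over intervals.
-/

/-! ### The Riemann–Lebesgue lemma and the Dirichlet integral -/

/-- The Riemann–Lebesgue lemma for the sine transform of a real function. -/
theorem tendsto_integral_mul_sin {k : ℝ → ℝ} (hk : Integrable k) :
    Tendsto (fun N : ℝ => ∫ t, k t * Real.sin (N * t)) atTop (𝓝 0) := by
  have h := Real.tendsto_integral_exp_smul_cocompact (fun t => (k t : ℂ))
  have hlim : Tendsto (fun N : ℝ => N / (2 * Real.pi)) atTop (cocompact ℝ) :=
    (tendsto_id.atTop_div_const (by positivity)).mono_right atTop_le_cocompact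
  have h2 := (Complex.continuous_im.tendsto _).comp (h.comp hlim)
  have h3 := h2.neg
  simp only [Complex.zero_im, neg_zero] at h3
  refine h3.congr fun N => ?_
  have hint : Integrable
      fun v : ℝ => Real.fourierChar (-(v * (N / (2 * Real.pi)))) • (k v : ℂ) := by
    refine (hk.ofReal (𝕜 := ℂ)).mono ?_ (ae_of_all _ fun v => by simp)
    refine Continuous.aestronglyMeasurable (by fun_prop) |>.smul
      (hk.ofReal (𝕜 := ℂ)).aestronglyMeasurable
  have h4 := integral_im hint
  simp only [RCLike.im_to_complex] at h4
  simp only [Function.comp_apply]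
  rw [← h4, ← integral_neg]
  refine integral_congr_ae (ae_of_all _ fun v => ?_)
  have hpi : (2 * Real.pi * -(v * (N / (2 * Real.pi)))) = -(N * v) := by
    field_simp
  simp only [Circle.smul_def, Real.fourierChar_apply, hpi, smul_eq_mul]
  rw [Complex.im_mul_ofReal, Complex.exp_ofReal_mul_I_im, Real.sin_neg]
  ring

theorem tendsto_setIntegral_mul_sin {k : ℝ → ℝ} {s : Set ℝ} (hs : MeasurableSet s)
    (hk : IntegrableOn k s) :
    Tendsto (fun N : ℝ => ∫ t in s, k t * Real.sin (N * t)) atTop (𝓝 0) := by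
  refine (tendsto_integral_mul_sin (hk.integrable_indicator hs)).congr fun N => ?_
  rw [← integral_indicator hs]
  exact integral_congr_ae (ae_of_all _ fun t => by by_cases h : t ∈ s <;> simp [h])

theorem abs_one_div_sub_one_div_sin_le {x : ℝ} (h0 : 0 < x) (h1 : x ≤ Real.pi / 2) :
    |1 / x - 1 / Real.sin x| ≤ Real.pi ^ 2 := by
  have hs : 2 / Real.pi * x ≤ Real.sin x := Real.mul_le_sin h0.le h1
  have hpi := Real.pi_pos
  have hs0 : 0 < Real.sin x := lt_of_lt_of_le (by positivity) hs
  have hlt : Real.sin x ≤ x := Real.sin_le h0.le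
  have hcos := Real.one_sub_sq_div_two_le_cos (x := x)
  have htan : x * Real.cos x ≤ Real.sin x := by
    rcases h1.eq_or_lt with h | h
    · rw [h, Real.cos_pi_div_two]; simp
    · have hc : 0 < Real.cos x := Real.cos_pos_of_mem_Ioo ⟨by linarith, h⟩
      have := (Real.lt_tan h0 h).le
      rwa [Real.tan_eq_sin_div_cos, le_div_iff₀ hc] at this
  have hx : x - Real.sin x ≤ x * (x ^ 2 / 2) := by nlinarith
  rw [div_sub_div _ _ h0.ne' hs0.ne', abs_div, abs_of_pos (mul_pos h0 hs0),
    div_le_iff₀ (mul_pos h0 hs0)]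
  rw [abs_of_nonpos (by linarith)]
  have h3 : x ≤ Real.pi * Real.sin x := by
    have h4 : Real.pi * (2 / Real.pi * x) ≤ Real.pi * Real.sin x := by gcongr
    have h5 : Real.pi * (2 / Real.pi * x) = 2 * x := by field_simp
    linarith
  have h6 : x ^ 2 / 2 ≤ Real.pi * (Real.pi * Real.sin x) := by nlinarith
  nlinarith

/-- The Dirichlet kernel, in the normalization with value `sin ((2 n + 1) x) / sin x`. -/
noncomputable def dirichletKer (n : ℕ) (x : ℝ) : ℝ :=
  1 + ∑ k ∈ Finset.range n, 2 * Real.cos (2 * (k + 1) * x)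

theorem dirichletKer_mul_sin (n : ℕ) (x : ℝ) :
    dirichletKer n x * Real.sin x = Real.sin ((2 * n + 1) * x) := by
  induction n with
  | zero => simp [dirichletKer]
  | succ n ih =>
    have h : dirichletKer (n + 1) x = dirichletKer n x + 2 * Real.cos (2 * (n + 1) * x) := by
      simp [dirichletKer, Finset.sum_range_succ]; ring
    rw [h, add_mul, ih]
    have e1 : (2 * ((n + 1 : ℕ) : ℝ) + 1) * x = 2 * (n + 1) * x + x := by push_cast; ring
    have e2 : (2 * (n : ℝ) + 1) * x = 2 * (n + 1) * x - x := by ring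
    rw [e1, e2, Real.sin_add, Real.sin_sub]
    ring

theorem integral_dirichletKer (n : ℕ) :
    ∫ x in (0 : ℝ)..(Real.pi / 2), dirichletKer n x = Real.pi / 2 := by
  unfold dirichletKer
  rw [intervalIntegral.integral_add (by simp) (Continuous.intervalIntegrable (by fun_prop) _ _),
    intervalIntegral.integral_finsetSum
      fun k _ => Continuous.intervalIntegrable (by fun_prop) _ _, Finset.sum_eq_zero]
  · simp
  · intro k _
    rw [intervalIntegral.integral_const_mul,
      intervalIntegral.integral_comp_mul_left (fun x => Real.cos x) (by positivity), integral_cos]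
    have : 2 * ((k : ℝ) + 1) * (Real.pi / 2) = ((k + 1 : ℕ) : ℝ) * Real.pi := by push_cast; ring
    rw [this, Real.sin_nat_mul_pi]
    simp

/-- The sine integral `∫₀ˣ sin t / t dt`. -/
noncomputable def sinIntegral (x : ℝ) : ℝ := ∫ t in (0 : ℝ)..x, Real.sinc t

theorem integral_mul_sinc_mul (M u v : ℝ) :
    ∫ t in u..v, M * Real.sinc (M * t) = sinIntegral (M * v) - sinIntegral (M * u) := by
  rw [intervalIntegral.integral_const_mul, intervalIntegral.mul_integral_comp_mul_left]
  unfold sinIntegral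
  rw [intervalIntegral.integral_interval_sub_left] <;>
    exact Real.continuous_sinc.intervalIntegrable _ _

theorem mul_sinc_mul {t : ℝ} (ht : t ≠ 0) (M : ℝ) :
    M * Real.sinc (M * t) = Real.sin (M * t) / t := by
  rcases eq_or_ne M 0 with rfl | hM
  · simp
  · rw [Real.sinc_of_ne_zero (mul_ne_zero hM ht)]
    field_simp

theorem continuous_sinIntegral : Continuous sinIntegral :=
  intervalIntegral.continuous_primitive
    (fun _ _ => Real.continuous_sinc.intervalIntegrable _ _) 0

/-- The limit of the sine integral along the odd multiples of `π / 2`: on `[0, π / 2]` the kernel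
`sin ((2 n + 1) x) / x` differs from the Dirichlet kernel, whose integral is `π / 2`, by
`sin ((2 n + 1) x)` times the bounded function `1 / x - 1 / sin x`. -/
theorem tendsto_sinIntegral_odd_mul_pi_div_two :
    Tendsto (fun n : ℕ => sinIntegral ((2 * n + 1) * (Real.pi / 2))) atTop (𝓝 (Real.pi / 2)) := by
  have hpi := Real.pi_pos
  have hint : IntegrableOn (fun x => 1 / x - 1 / Real.sin x) (Ioc 0 (Real.pi / 2)) := by
    refine Measure.integrableOn_of_bounded (M := Real.pi ^ 2) (by simp)
      (Measurable.aestronglyMeasurable (by fun_prop)) ?_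
    filter_upwards [ae_restrict_mem measurableSet_Ioc] with x hx
    exact abs_one_div_sub_one_div_sin_le hx.1 hx.2
  have hN : Tendsto (fun n : ℕ => (2 * n + 1 : ℝ)) atTop atTop :=
    tendsto_atTop_add_const_right _ _ (tendsto_natCast_atTop_atTop.const_mul_atTop two_pos)
  have h := (tendsto_setIntegral_mul_sin measurableSet_Ioc hint).comp hN
  have h' := h.const_add (Real.pi / 2)
  rw [add_zero] at h'
  refine h'.congr fun n => ?_
  have e1 : sinIntegral ((2 * n + 1) * (Real.pi / 2)) =
      ∫ t in (0 : ℝ)..(Real.pi / 2), (2 * n + 1 : ℝ) * Real.sinc ((2 * n + 1) * t) := by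
    rw [integral_mul_sinc_mul]; simp [sinIntegral]
  have e2 : ∫ t in (0 : ℝ)..(Real.pi / 2), (2 * n + 1 : ℝ) * Real.sinc ((2 * n + 1) * t) =
      ∫ t in (0 : ℝ)..(Real.pi / 2), (dirichletKer n t +
        (1 / t - 1 / Real.sin t) * Real.sin ((2 * n + 1) * t)) := by
    refine intervalIntegral.integral_congr_ae (ae_of_all _ fun t ht => ?_)
    rw [uIoc_of_le (by positivity)] at ht
    have hs : Real.sin t ≠ 0 := (Real.sin_pos_of_pos_of_lt_pi ht.1 (by linarith [ht.2])).ne'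
    rw [mul_sinc_mul ht.1.ne', sub_mul, one_div_mul_eq_div, one_div_mul_eq_div,
      ← dirichletKer_mul_sin, mul_div_cancel_right₀ _ hs]
    ring
  rw [e1, e2, intervalIntegral.integral_add, integral_dirichletKer,
    intervalIntegral.integral_of_le (by positivity)]
  · rfl
  · unfold dirichletKer
    exact Continuous.intervalIntegrable (by fun_prop) _ _
  · rw [intervalIntegrable_iff_integrableOn_Ioc_of_le (by positivity)]
    exact hint.mul_bdd (c := 1) (Continuous.aestronglyMeasurable (by fun_prop))
      (ae_of_all _ fun t => Real.abs_sin_le_one _)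

theorem abs_sinIntegral_sub_le {x y c : ℝ} (hc : 0 < c) (hx : c ≤ x) (hy : c ≤ y) :
    |sinIntegral y - sinIntegral x| ≤ |y - x| / c := by
  have h : sinIntegral y - sinIntegral x = ∫ t in x..y, Real.sinc t :=
    intervalIntegral.integral_interval_sub_left (Real.continuous_sinc.intervalIntegrable _ _)
      (Real.continuous_sinc.intervalIntegrable _ _)
  rw [h, div_eq_inv_mul, ← Real.norm_eq_abs (∫ t in x..y, Real.sinc t)]
  refine intervalIntegral.norm_integral_le_of_norm_le_const fun t ht => ?_
  have ht0 : c ≤ t := (le_min hx hy).trans ht.1.le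
  have htp : 0 < t := hc.trans_le ht0
  rw [Real.sinc_of_ne_zero htp.ne', Real.norm_eq_abs, abs_div, abs_of_pos htp, ← one_div]
  gcongr
  exact Real.abs_sin_le_one t

/-- The Dirichlet integral; the sine integral varies little between `x` and a neighboring odd
multiple of `π / 2`. -/
theorem tendsto_sinIntegral : Tendsto sinIntegral atTop (𝓝 (Real.pi / 2)) := by
  have hpi := Real.pi_pos
  have hfl : Tendsto (fun x : ℝ => ⌊x / Real.pi⌋₊) atTop atTop :=
    tendsto_nat_floor_atTop.comp (tendsto_id.atTop_div_const hpi)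
  have h1 := tendsto_sinIntegral_odd_mul_pi_div_two.comp hfl
  have h2 : Tendsto (fun x : ℝ => sinIntegral x -
      sinIntegral ((2 * ⌊x / Real.pi⌋₊ + 1) * (Real.pi / 2))) atTop (𝓝 0) := by
    have h3 : Tendsto (fun x : ℝ => Real.pi / (x - Real.pi)) atTop (𝓝 0) :=
      (tendsto_atTop_add_const_right _ (-Real.pi) tendsto_id).const_div_atTop _
    refine squeeze_zero_norm' ?_ h3
    filter_upwards [eventually_gt_atTop Real.pi] with x hx
    have hle : (⌊x / Real.pi⌋₊ : ℝ) * Real.pi ≤ x :=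
      (le_div_iff₀ hpi).1 (Nat.floor_le (div_nonneg (hpi.le.trans hx.le) hpi.le))
    have hlt : x < (⌊x / Real.pi⌋₊ + 1 : ℝ) * Real.pi :=
      (div_lt_iff₀ hpi).1 (Nat.lt_floor_add_one _)
    refine (abs_sinIntegral_sub_le (c := x - Real.pi) (by linarith) (by linarith)
      (by linarith)).trans ?_
    have : 0 < x - Real.pi := by linarith
    gcongr
    rw [abs_le]
    constructor <;> linarith
  have := h2.add h1
  simpa using this

/-- A bound for the integrals of `M sinc (M t)` over intervals, uniform in the frequency `M`. -/
theorem exists_abs_sinIntegral_sub_le :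
    ∃ B : ℝ, 0 < B ∧ ∀ x y : ℝ, 0 ≤ x → 0 ≤ y → |sinIntegral y - sinIntegral x| ≤ B := by
  obtain ⟨X, hX⟩ := eventually_atTop.1
    (tendsto_sinIntegral.abs.eventually (gt_mem_nhds (lt_add_one |Real.pi / 2|)))
  obtain ⟨C, hC⟩ := (isCompact_Icc (a := 0) (b := X)).exists_bound_of_continuousOn
    continuous_sinIntegral.continuousOn
  have hb : ∀ x : ℝ, 0 ≤ x → |sinIntegral x| ≤ max C (|Real.pi / 2| + 1) := fun x hx => by
    rcases le_total x X with h | h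
    · exact (hC x ⟨hx, h⟩).trans (le_max_left _ _)
    · exact (hX x h).le.trans (le_max_right _ _)
  refine ⟨2 * max C (|Real.pi / 2| + 1),
    mul_pos two_pos (lt_max_of_lt_right (by positivity)), fun x y hx hy => ?_⟩
  calc _ ≤ |sinIntegral y| + |sinIntegral x| := abs_sub _ _
    _ ≤ _ := by linarith [hb x hx, hb y hy]

/-! ### Integrals of functions of bounded variation against oscillating kernels -/

/-- A lower subset of an interval is an interval, up to a null set. -/
theorem exists_ae_eq_Ioc {x y : ℝ} (hxy : x ≤ y) {S : Set ℝ} (hS : S ⊆ Ioc x y)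
    (hlow : ∀ t ∈ S, ∀ u, x < u → u ≤ t → u ∈ S) :
    ∃ z ∈ Icc x y, S =ᵐ[volume] Ioc x z := by
  have hbdd : BddAbove (insert x S) := ⟨y, by
    rintro t (rfl | ht)
    exacts [hxy, (hS ht).2]⟩
  refine ⟨sSup (insert x S),
    ⟨le_csSup hbdd (mem_insert _ _), csSup_le (insert_nonempty _ _) ?_⟩, ?_⟩
  · rintro t (rfl | ht)
    exacts [hxy, (hS ht).2]
  · have h1 : S ⊆ Ioc x (sSup (insert x S)) := fun t ht =>
      ⟨(hS ht).1, le_csSup hbdd (mem_insert_of_mem _ ht)⟩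
    have h2 : Ioo x (sSup (insert x S)) ⊆ S := fun t ht => by
      obtain ⟨u, hu, htu⟩ := exists_lt_of_lt_csSup (insert_nonempty _ _) ht.2
      rcases hu with rfl | hu
      · exact absurd ht.1 htu.not_gt
      · exact hlow u hu t ht.1 htu.le
    exact h1.eventuallyLE.antisymm (Ioo_ae_eq_Ioc.symm.le.trans h2.eventuallyLE)

/-- The second mean value theorem as an inequality: the layer cake formula writes an antitone `g`
as a superposition of indicators of initial segments of `(x, y]`. -/
theorem abs_integral_antitone_mul_le {g D : ℝ → ℝ} {x y c B : ℝ} (hxy : x ≤ y) (hc : 0 ≤ c)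
    (hg : Antitone g) (hgm : ∀ t ∈ Ioc x y, g t ∈ Icc 0 c) (hD : Continuous D)
    (hB : ∀ u ∈ Icc x y, |∫ t in x..u, D t| ≤ B) :
    |∫ t in x..y, g t * D t| ≤ B * c := by
  have hmeas : MeasurableSet {p : ℝ × ℝ | p.2 ≤ g p.1} :=
    measurableSet_le measurable_snd (hg.measurable.comp measurable_fst)
  -- `D` on the subgraph of `g`; integrating out `r` gives `g t * D t`
  let K : ℝ → ℝ → ℝ := fun t r => {p : ℝ × ℝ | p.2 ≤ g p.1}.indicator (fun p => D p.1) (t, r)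
  have hlayer : ∀ t ∈ Ioc x y, g t * D t = ∫ r in Ioc 0 c, K t r := by
    intro t ht
    have : ∀ r, K t r = (Iic (g t)).indicator (fun _ => D t) r := fun r => by
      simp [K, indicator_apply]
    simp_rw [this]
    rw [setIntegral_indicator measurableSet_Iic, Ioc_inter_Iic, setIntegral_const,
      min_eq_right (hgm t ht).2]
    simp [(hgm t ht).1]
  have hint : Integrable (Function.uncurry K)
      ((volume.restrict (Ioc x y)).prod (volume.restrict (Ioc 0 c))) := by
    have h1 : Integrable (fun p : ℝ × ℝ => D p.1)
        ((volume.restrict (Ioc x y)).prod (volume.restrict (Ioc 0 c))) := by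
      have h2 : IntegrableOn D (Ioc x y) := (hD.integrableOn_Icc).mono_set Ioc_subset_Icc_self
      exact h2.comp_fst _
    exact h1.indicator hmeas
  rw [intervalIntegral.integral_of_le hxy, setIntegral_congr_fun measurableSet_Ioc hlayer,
    integral_integral_swap hint]
  have hB' : ∀ r ∈ Ioc 0 c, ‖∫ t in Ioc x y, K t r‖ ≤ B := by
    intro r _
    have hKr : ∀ t, K t r = {t | r ≤ g t}.indicator D t := fun t => by simp [K, indicator_apply]
    simp_rw [hKr]
    rw [setIntegral_indicator (measurableSet_le measurable_const hg.measurable)]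
    obtain ⟨z, hz, hSz⟩ := exists_ae_eq_Ioc (S := Ioc x y ∩ {t | r ≤ g t}) hxy inter_subset_left
      fun t ht u hxu hut => ⟨⟨hxu, hut.trans ht.1.2⟩, le_trans ht.2 (hg hut)⟩
    rw [setIntegral_congr_set hSz, ← intervalIntegral.integral_of_le hz.1]
    exact hB z hz
  refine (norm_setIntegral_le_of_norm_le_const (by simp) hB').trans ?_
  simp [hc]

/-- The version for a monotone function with values in `[-c, 0]` on a half-open interval, extended by
`-c` to the left and by `0` to the right; nothing is asked of its value at the left end. -/
theorem abs_integral_mul_le_of_monotoneOn {φ D : ℝ → ℝ} {x y c B : ℝ} (hxy : x ≤ y) (hc : 0 ≤ c)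
    (hφ : MonotoneOn φ (Ioc x y)) (hm : ∀ t ∈ Ioc x y, φ t ∈ Icc (-c) 0)
    (hD : Continuous D) (hB : ∀ u ∈ Icc x y, |∫ t in x..u, D t| ≤ B) :
    IntervalIntegrable (fun t => φ t * D t) volume x y ∧ |∫ t in x..y, φ t * D t| ≤ B * c := by
  let g : ℝ → ℝ := fun t => if t ≤ x then c else if t ≤ y then - φ t else 0
  have hg : Antitone g := by
    intro s t hst
    simp only [g]
    split_ifs with h1 h2 h3 h4 h5 h6 h7
    all_goals first
      | exact le_rfl
      | exact hc
      | (exfalso; linarith)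
      | skip
    · have := (hm t ⟨by linarith, by assumption⟩).1; linarith
    · have := hφ ⟨by linarith, by assumption⟩ ⟨by linarith, by assumption⟩ hst; linarith
    · have := (hm s ⟨by linarith, by assumption⟩).2; linarith
  have hgφ : ∀ t ∈ Ioc x y, g t = - φ t := fun t ht => by simp [g, ht.1.not_ge, ht.2]
  have hcongr : EqOn (fun t => φ t * D t) (fun t => -(g t * D t)) (Ioc x y) := fun t ht => by
    simp [hgφ t ht]
  have hint : IntervalIntegrable (fun t => g t * D t) volume x y :=
    (hg.antitoneOn _).intervalIntegrable.mul_continuousOn hD.continuousOn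
  constructor
  · rw [intervalIntegrable_iff_integrableOn_Ioc_of_le hxy] at hint ⊢
    exact hint.neg.congr_fun hcongr.symm measurableSet_Ioc
  · have : ∫ t in x..y, φ t * D t = -∫ t in x..y, g t * D t := by
      rw [← intervalIntegral.integral_neg, intervalIntegral.integral_of_le hxy,
        intervalIntegral.integral_of_le hxy]
      exact setIntegral_congr_fun measurableSet_Ioc hcongr
    rw [this, abs_neg]
    refine abs_integral_antitone_mul_le hxy hc hg (fun t ht => ?_) hD hB
    rw [hgφ t ht]
    exact ⟨by linarith [(hm t ht).2], by linarith [(hm t ht).1]⟩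

/-- `φ` varies on `s` at most as much as the (then monotone) function `R`. -/
def VariesBy (φ R : ℝ → ℝ) (s : Set ℝ) : Prop :=
  ∀ x ∈ s, ∀ y ∈ s, x ≤ y → |φ y - φ x| ≤ R y - R x

theorem VariesBy.mono {φ R : ℝ → ℝ} {s t : Set ℝ} (h : VariesBy φ R s) (hts : t ⊆ s) :
    VariesBy φ R t := fun x hx y hy hxy => h x (hts hx) y (hts hy) hxy

theorem VariesBy.monotoneOn {φ R : ℝ → ℝ} {s : Set ℝ} (h : VariesBy φ R s) : MonotoneOn R s :=
  fun x hx y hy hxy => sub_nonneg.1 ((abs_nonneg _).trans (h x hx y hy hxy))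

/-- The second mean value inequality for a function of bounded variation, from the decomposition
`φ = (φ + R) - R` into monotone functions. -/
theorem VariesBy.integral_mul {φ R D : ℝ → ℝ} {x y ρ B : ℝ} (hxy : x < y)
    (h : VariesBy φ R (Ioc x y)) (hρ : ∀ t ∈ Ioc x y, ρ ≤ R t)
    (hD : Continuous D) (hB : ∀ u ∈ Icc x y, |∫ t in x..u, D t| ≤ B) :
    IntervalIntegrable (fun t => φ t * D t) volume x y ∧
      |(∫ t in x..y, φ t * D t) - φ y * ∫ t in x..y, D t| ≤ 3 * B * (R y - ρ) := by
  have hy : y ∈ Ioc x y := ⟨hxy, le_rfl⟩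
  have hc : 0 ≤ R y - ρ := by linarith [hρ y hy]
  obtain ⟨i1, b1⟩ := abs_integral_mul_le_of_monotoneOn (φ := fun t => R t - R y) hxy.le hc
    (fun s hs t ht hst => by have := h.monotoneOn hs ht hst; simpa using this)
    (fun t ht => ⟨by have := hρ t ht; linarith, by linarith [h.monotoneOn ht hy ht.2]⟩) hD hB
  obtain ⟨i2, b2⟩ := abs_integral_mul_le_of_monotoneOn (φ := fun t => (φ t + R t) - (φ y + R y))
    (c := 2 * (R y - ρ)) hxy.le (by linarith)
    (fun s hs t ht hst => by have := abs_le.1 (h s hs t ht hst); simp only; linarith)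
    (fun t ht => by
      have := abs_le.1 (h t ht y hy ht.2)
      have := hρ t ht
      constructor <;> linarith) hD hB
  have iD : IntervalIntegrable (fun t => φ y * D t) volume x y :=
    (hD.intervalIntegrable _ _).const_mul _
  have e : (fun t => φ t * D t) = fun t => ((φ t + R t - (φ y + R y)) * D t - (R t - R y) * D t) +
      φ y * D t := by
    funext t; ring
  constructor
  · rw [e]; exact (i2.sub i1).add iD
  · rw [e, intervalIntegral.integral_add (i2.sub i1) iD, intervalIntegral.integral_sub i2 i1,
      intervalIntegral.integral_const_mul, add_sub_cancel_right]
    exact (abs_sub _ _).trans (by linarith)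

/-- A Jordan-type theorem for a family of functions: if all `φ i` vary at most as much as one
function `R` and `φ i → ψ` pointwise, then the Dirichlet integrals of `φ i` tend to
`ψ(0+) π / 2` as the frequency and the index tend to infinity independently. -/
theorem tendsto_integral_mul_sinc {ι : Type*} {l : Filter ι} {φ : ι → ℝ → ℝ} {ψ R : ℝ → ℝ}
    {a ρ L : ℝ} (ha : 0 < a) (hφ : ∀ᶠ i in l, VariesBy (φ i) R (Ioc 0 a))
    (hρ : ∀ t ∈ Ioc 0 a, ρ ≤ R t)
    (hlim : ∀ t ∈ Ioc 0 a, Tendsto (fun i => φ i t) l (𝓝 (ψ t)))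
    (hL : Tendsto ψ (𝓝[>] 0) (𝓝 L)) :
    Tendsto (fun p : ℝ × ι => ∫ t in (0 : ℝ)..a, φ p.2 t * (p.1 * Real.sinc (p.1 * t)))
      (atTop ×ˢ l) (𝓝 (L * (Real.pi / 2))) := by
  rcases l.eq_or_neBot with rfl | hne
  · simp
  obtain ⟨B, hBpos, hB⟩ := exists_abs_sinIntegral_sub_le
  have hR : MonotoneOn R (Ioc 0 a) := by
    obtain ⟨i, hi⟩ := hφ.exists
    exact hi.monotoneOn
  -- the lower bound `ρ` can be replaced by the right limit of `R` at `0`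
  obtain ⟨ρ', hρ', hRlim⟩ : ∃ ρ', (∀ t ∈ Ioc 0 a, ρ' ≤ R t) ∧ Tendsto R (𝓝[>] 0) (𝓝 ρ') := by
    have hbdd : BddBelow (R '' Ioc 0 a) := ⟨ρ, by rintro _ ⟨t, ht, rfl⟩; exact hρ t ht⟩
    have hne : (R '' Ioc 0 a).Nonempty := ⟨R a, a, ⟨ha, le_rfl⟩, rfl⟩
    refine ⟨sInf (R '' Ioc 0 a), fun t ht => csInf_le hbdd ⟨t, ht, rfl⟩, ?_⟩
    refine tendsto_order.2 ⟨fun r hr => ?_, fun r hr => ?_⟩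
    · filter_upwards [Ioc_mem_nhdsGT ha] with t ht
      exact hr.trans_le (csInf_le hbdd ⟨t, ht, rfl⟩)
    · obtain ⟨_, ⟨s, hs, rfl⟩, hsr⟩ := exists_lt_of_csInf_lt hne hr
      filter_upwards [Ioc_mem_nhdsGT hs.1] with t ht
      exact (hR ⟨ht.1, ht.2.trans hs.2⟩ hs ht.2).trans_lt hsr
  rw [Metric.tendsto_nhds]
  intro ε hε
  have hpi := Real.pi_pos
  obtain ⟨δ, hδ, hδR, hδψ⟩ : ∃ δ ∈ Ioc 0 a, 3 * B * (R δ - ρ') < ε / 3 ∧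
      |ψ δ * (Real.pi / 2) - L * (Real.pi / 2)| < ε / 3 := by
    have h1 : Tendsto (fun t => 3 * B * (R t - ρ')) (𝓝[>] 0) (𝓝 (3 * B * (ρ' - ρ'))) :=
      (hRlim.sub_const _).const_mul _
    have h2 : Tendsto (fun t => |ψ t * (Real.pi / 2) - L * (Real.pi / 2)|) (𝓝[>] 0)
        (𝓝 |L * (Real.pi / 2) - L * (Real.pi / 2)|) :=
      ((hL.mul_const _).sub_const _).abs
    rw [sub_self, mul_zero] at h1
    rw [sub_self, abs_zero] at h2
    have hε3 : 0 < ε / 3 := by positivity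
    obtain ⟨δ, h⟩ := ((eventually_mem_set.2 (Ioc_mem_nhdsGT ha)).and
      ((h1.eventually (gt_mem_nhds hε3)).and (h2.eventually (gt_mem_nhds hε3)))).exists
    exact ⟨δ, h.1, h.2.1, h.2.2⟩
  have haI : a ∈ Ioc 0 a := ⟨ha, le_rfl⟩
  -- away from the origin the kernel has small primitives
  have hfar : Tendsto (fun p : ℝ × ι => ∫ t in δ..a, φ p.2 t * (p.1 * Real.sinc (p.1 * t)))
      (atTop ×ˢ l) (𝓝 0) := by
    let C : ℝ := |ψ a| + 1 + 3 * (R a - ρ')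
    have hCpos : 0 < C := by have := hρ' a haI; positivity
    rcases hδ.2.eq_or_lt with hδa | hδa
    · simp [hδa]
    rw [Metric.tendsto_nhds]
    intro η hη
    have hSi := tendsto_sinIntegral.eventually
      (Metric.ball_mem_nhds _ (ε := η / (2 * C) / 2) (by positivity))
    obtain ⟨X, hX⟩ := eventually_atTop.1 hSi
    have hψa : ∀ᶠ i in l, |φ i a| < |ψ a| + 1 :=
      (hlim a haI).abs.eventually (gt_mem_nhds (lt_add_one _))
    filter_upwards [((eventually_ge_atTop (X / δ)).and (eventually_ge_atTop 0)).prod_mk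
      (hψa.and hφ)] with ⟨M, i⟩ ⟨⟨hM, hM0⟩, hi, hφi⟩
    simp only at hM hM0 hi hφi ⊢
    have hprim : ∀ u ∈ Icc δ a, |∫ t in δ..u, M * Real.sinc (M * t)| ≤ η / (2 * C) := by
      intro u hu
      rw [integral_mul_sinc_mul]
      have k1 : X ≤ M * δ := by rwa [div_le_iff₀ hδ.1] at hM
      have k2 : X ≤ M * u := k1.trans (by gcongr; exact hu.1)
      have := dist_triangle_right (sinIntegral (M * u)) (sinIntegral (M * δ)) (Real.pi / 2)
      rw [Real.dist_eq] at this
      have h1 := hX _ k1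
      have h2 := hX _ k2
      linarith
    obtain ⟨-, hb⟩ := (hφi.mono (Ioc_subset_Ioc_left hδ.1.le)).integral_mul hδa
      (fun t ht => hρ' t ⟨hδ.1.trans ht.1, ht.2⟩)
      (D := fun t => M * Real.sinc (M * t)) (by have := Real.continuous_sinc; fun_prop) hprim
    rw [dist_zero_right, Real.norm_eq_abs]
    have hb2 : |φ i a * ∫ t in δ..a, M * Real.sinc (M * t)| ≤ (|ψ a| + 1) * (η / (2 * C)) := by
      rw [abs_mul]
      gcongr
      exact hprim a ⟨hδa.le, le_rfl⟩
    have e : η / (2 * C) * C = η / 2 := by field_simp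
    have e2 : 3 * (η / (2 * C)) * (R a - ρ') + (|ψ a| + 1) * (η / (2 * C)) = η / (2 * C) * C := by
      simp only [C]; ring
    have := abs_sub_abs_le_abs_sub (∫ t in δ..a, φ i t * (M * Real.sinc (M * t)))
      (φ i a * ∫ t in δ..a, M * Real.sinc (M * t))
    linarith
  -- near the origin `φ i` is replaced by the constant `φ i δ`
  have hmid : Tendsto (fun p : ℝ × ι => φ p.2 δ * sinIntegral (p.1 * δ)) (atTop ×ˢ l)
      (𝓝 (ψ δ * (Real.pi / 2))) :=
    ((hlim δ hδ).comp tendsto_snd).mul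
      ((tendsto_sinIntegral.comp (tendsto_id.atTop_mul_const hδ.1)).comp tendsto_fst)
  have hsum := (hmid.add hfar).sub_const (ψ δ * (Real.pi / 2))
  rw [add_zero, sub_self] at hsum
  filter_upwards [Metric.tendsto_nhds.1 hsum (ε / 3) (by positivity),
    (eventually_ge_atTop (0 : ℝ)).prod_mk hφ] with ⟨M, i⟩ h1 ⟨hM, hφi⟩
  simp only at h1 hM hφi ⊢
  have hcont : Continuous fun t => M * Real.sinc (M * t) := by
    have := Real.continuous_sinc; fun_prop
  obtain ⟨j1, b1⟩ := (hφi.mono (Ioc_subset_Ioc_right hδ.2)).integral_mul hδ.1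
    (fun t ht => hρ' t ⟨ht.1, ht.2.trans hδ.2⟩) hcont (B := B) fun u hu => by
      rw [integral_mul_sinc_mul]
      exact hB _ _ (by simp) (mul_nonneg hM hu.1)
  have j2 : IntervalIntegrable (fun t => φ i t * (M * Real.sinc (M * t))) volume 0 a :=
    (hφi.integral_mul ha hρ' hcont (B := B) fun u hu => by
      rw [integral_mul_sinc_mul]
      exact hB _ _ (by simp) (mul_nonneg hM hu.1)).1
  have hsplit := intervalIntegral.integral_add_adjacent_intervals j1
    (j2.mono_set (by
      rw [uIcc_of_le hδ.2, uIcc_of_le ha.le]; exact Icc_subset_Icc_left hδ.1.le))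
  have e0 : sinIntegral (M * δ) = ∫ t in (0 : ℝ)..δ, M * Real.sinc (M * t) := by
    rw [integral_mul_sinc_mul]; simp [sinIntegral]
  rw [← hsplit, Real.dist_eq]
  rw [dist_zero_right, Real.norm_eq_abs, e0] at h1
  have t1 := abs_lt.1 h1
  have t2 := abs_lt.1 hδψ
  have t3 := abs_le.1 b1
  rw [abs_lt]
  constructor <;> linarith

/-! ### The variation of a function as a supremum over nets -/

namespace eVariationOn

variable {α E : Type*} [LinearOrder α] [PseudoEMetricSpace E]

/-- The variation on `s` is the supremum of the variations on the finite subsets of `s`, and one may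
restrict to those containing `F₀`. -/
theorem eq_iSup_finset (f : α → E) {s : Set α} {F₀ : Finset α} (hF₀ : (F₀ : Set α) ⊆ s) :
    eVariationOn f s =
      ⨆ F : {F : Finset α // F₀ ⊆ F ∧ (F : Set α) ⊆ s}, eVariationOn f (F : Set α) := by
  classical
  refine le_antisymm (iSup_le ?_) (iSup_le fun F => eVariationOn.mono f F.2.2)
  rintro ⟨n, u, hu, hus⟩
  let F : Finset α := F₀ ∪ (Finset.range (n + 1)).image u
  have hF : F₀ ⊆ F ∧ (F : Set α) ⊆ s := by
    refine ⟨Finset.subset_union_left, ?_⟩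
    intro x hx
    simp only [F, Finset.coe_union, Finset.coe_image, mem_union, mem_image] at hx
    rcases hx with hx | ⟨i, -, rfl⟩
    exacts [hF₀ hx, hus i]
  refine le_trans ?_ (le_iSup _ (⟨F, hF⟩ : {F : Finset α // F₀ ⊆ F ∧ (F : Set α) ⊆ s}))
  refine sum_le_of_monotoneOn_Iic (hu.monotoneOn _) fun i hi => ?_
  exact Finset.mem_coe.2 (Finset.mem_union_right _
    (Finset.mem_image_of_mem _ (Finset.mem_range.2 (Nat.lt_succ_of_le hi))))

/-- Finitely many variations can be approximated along one common finite set of points. -/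
theorem sum_eq_iSup_finset {ι : Type*} (I : Finset ι) (f : ι → α → E) {s : Set α} {F₀ : Finset α}
    (hF₀ : (F₀ : Set α) ⊆ s) :
    ∑ i ∈ I, eVariationOn (f i) s =
      ⨆ F : {F : Finset α // F₀ ⊆ F ∧ (F : Set α) ⊆ s},
        ∑ i ∈ I, eVariationOn (f i) (F : Set α) := by
  classical
  rw [← ENNReal.finsetSum_iSup]
  · simp_rw [← eq_iSup_finset _ hF₀]
  · intro F G
    refine ⟨⟨F ∪ G, F.2.1.trans Finset.subset_union_left, ?_⟩, fun i => ⟨?_, ?_⟩⟩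
    · rw [Finset.coe_union]; exact union_subset F.2.2 G.2.2
    · exact eVariationOn.mono _ (by simp)
    · exact eVariationOn.mono _ (by simp)

end eVariationOn

namespace FourierInversion2D

theorem exists_isNet_of_finset {a b : ℝ} (hab : a < b) {F : Finset ℝ} (ha : a ∈ F) (hb : b ∈ F)
    (hF : (F : Set ℝ) ⊆ Icc a b) :
    ∃ (n : ℕ) (t : ℕ → ℝ), IsNet a b n t ∧ Monotone t ∧ (F : Set ℝ) = t '' Iic n := by
  have hcard : 1 < F.card := Finset.one_lt_card.2 ⟨a, ha, b, hb, hab.ne⟩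
  let t : ℕ → ℝ := fun n => F.orderEmbOfFin rfl ⟨min n (F.card - 1), by omega⟩
  have hF_eq : (F : Set ℝ) = t '' Iic (F.card - 1) := by
    ext
    simp only [← F.range_orderEmbOfFin rfl, mem_image, mem_Iic, mem_range, t]
    constructor
    · rintro ⟨i, rfl⟩; exact ⟨i.val, by grind⟩
    · rintro ⟨i, hi, rfl⟩; use ⟨i, by omega⟩; congr; omega
  have hmono : Monotone t := fun _ _ _ => OrderEmbedding.monotone _ (by grind)
  have hmem : ∀ n, t n ∈ Icc a b := fun n => hF (Finset.orderEmbOfFin_mem F rfl _)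
  refine ⟨F.card - 1, t, ⟨?_, ?_, fun i hi => ?_⟩, hmono, hF_eq⟩
  · obtain ⟨i, -, hi⟩ := hF_eq ▸ (Finset.mem_coe.2 ha)
    exact le_antisymm (hi ▸ hmono (Nat.zero_le i)) (hmem 0).1
  · obtain ⟨i, hin, hi⟩ := hF_eq ▸ (Finset.mem_coe.2 hb)
    exact le_antisymm (hmem _).2 (hi ▸ hmono hin)
  · refine (F.orderEmbOfFin rfl).strictMono ?_
    rw [Fin.mk_lt_mk]
    omega

/-- A bound for sums over all common nets bounds the sum of the variations, although each variation
is a supremum over nets of its own. -/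
theorem sum_eVariationOn_le_of_isNet {ι E : Type*} [PseudoEMetricSpace E] (I : Finset ι)
    (f : ι → ℝ → E) {a b : ℝ} (hab : a < b) {C : ENNReal}
    (h : ∀ (n : ℕ) (t : ℕ → ℝ), IsNet a b n t →
      ∑ i ∈ I, ∑ j ∈ Finset.range n, edist (f i (t j)) (f i (t (j + 1))) ≤ C) :
    ∑ i ∈ I, eVariationOn (f i) (Icc a b) ≤ C := by
  have hF₀ : (({a, b} : Finset ℝ) : Set ℝ) ⊆ Icc a b := by
    intro x hx
    simp only [Finset.coe_insert, Finset.coe_singleton, mem_insert_iff, mem_singleton_iff] at hx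
    rcases hx with rfl | rfl
    exacts [left_mem_Icc.2 hab.le, right_mem_Icc.2 hab.le]
  rw [eVariationOn.sum_eq_iSup_finset I f hF₀]
  refine iSup_le fun ⟨F, hFab, hF⟩ => ?_
  obtain ⟨n, t, ht, hmono, hFt⟩ :=
    exists_isNet_of_finset hab (hFab (by simp)) (hFab (by simp)) hF
  simp_rw [hFt, eVariationOn.image_range_of_monotone _ hmono]
  exact h n t ht

/-! ### Functions of bounded variation in the sense of Hardy -/

theorem eVariationOn_add_le (φ ψ : ℝ → ℝ) (s : Set ℝ) :
    eVariationOn (fun t => φ t + ψ t) s ≤ eVariationOn φ s + eVariationOn ψ s := by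
  refine iSup_le fun ⟨n, u, hu, hus⟩ => ?_
  calc _ ≤ ∑ i ∈ Finset.range n, (edist (φ (u (i + 1))) (φ (u i)) +
        edist (ψ (u (i + 1))) (ψ (u i))) := Finset.sum_le_sum fun i _ => edist_add_add_le _ _ _ _
    _ ≤ _ := by
      rw [Finset.sum_add_distrib]
      exact add_le_add (eVariationOn.sum_le hu hus) (eVariationOn.sum_le hu hus)

theorem eVariationOn_sub_comm (φ ψ : ℝ → ℝ) (s : Set ℝ) :
    eVariationOn (fun t => φ t - ψ t) s = eVariationOn (fun t => ψ t - φ t) s := by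
  unfold eVariationOn
  congr 1 with p
  congr 1 with i
  rw [← edist_neg_neg, neg_sub, neg_sub]

/-- Real functions, with the variation on `J` of the difference of two functions as their
distance. The variation of `s ↦ f (s, ·)` as a map into this space is the two-dimensional
variation of `f`. -/
def SectionSpace (_J : Set ℝ) : Type := ℝ → ℝ

noncomputable instance (J : Set ℝ) : PseudoEMetricSpace (SectionSpace J) where
  edist φ ψ := eVariationOn (fun t => φ t - ψ t) J
  edist_self φ := by
    simp only [sub_self]
    exact eVariationOn.constant_on (by rintro _ ⟨_, -, rfl⟩ _ ⟨_, -, rfl⟩; rfl)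
  edist_comm φ ψ := eVariationOn_sub_comm φ ψ J
  edist_triangle φ ψ χ := by
    refine le_of_eq_of_le ?_ (eVariationOn_add_le (fun t => φ t - ψ t) (fun t => ψ t - χ t) J)
    simp

theorem SectionSpace.edist_def {J : Set ℝ} (φ ψ : SectionSpace J) :
    edist φ ψ = eVariationOn (fun t => φ t - ψ t) J := rfl

theorem eVariationOn_eq_ofReal_variationOnFromTo {E : Type*} [PseudoEMetricSpace E] {φ : ℝ → E}
    {a b x y : ℝ} (hφ : BoundedVariationOn φ (Icc a b)) (hx : x ∈ Icc a b) (hy : y ∈ Icc a b)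
    (hxy : x ≤ y) :
    eVariationOn φ (Icc a b ∩ Icc x y) = ENNReal.ofReal
      (variationOnFromTo φ (Icc a b) a y - variationOnFromTo φ (Icc a b) a x) := by
  have ha : a ∈ Icc a b := left_mem_Icc.2 (hx.1.trans hx.2)
  rw [variationOnFromTo.sub_right hφ.locallyBoundedVariationOn ha hy hx,
    variationOnFromTo.eq_of_le _ _ hxy, ENNReal.ofReal_toReal (hφ.mono inter_subset_left)]

theorem _root_.BoundedVariationOn.variesBy {φ : ℝ → ℝ} {a b : ℝ}
    (hφ : BoundedVariationOn φ (Icc a b)) :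
    VariesBy φ (variationOnFromTo φ (Icc a b) a) (Icc a b) := by
  intro x hx y hy hxy
  have h := eVariationOn.edist_le φ (s := Icc a b ∩ Icc x y) (x := y) (y := x)
    ⟨hy, hxy, le_rfl⟩ ⟨hx, le_rfl, hxy⟩
  rw [eVariationOn_eq_ofReal_variationOnFromTo hφ hx hy hxy, edist_dist, Real.dist_eq] at h
  have ha : a ∈ Icc a b := left_mem_Icc.2 (hx.1.trans hx.2)
  exact (ENNReal.ofReal_le_ofReal_iff (sub_nonneg.2
    (variationOnFromTo.monotoneOn hφ.locallyBoundedVariationOn ha hx hy hxy))).1 h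

/-- The working form of bounded variation in the sense of Hardy: as the first variable runs over
`I`, the sections `h s` move at most as much as the function `R`, with respect to both the
variation on `J` and the sup norm on `J`, and each of them is of bounded variation on `J`. -/
structure HardyControl (h : ℝ → ℝ → ℝ) (R : ℝ → ℝ) (I J : Set ℝ) : Prop where
  variation_le : ∀ s ∈ I, ∀ s' ∈ I, s ≤ s' →
    eVariationOn (fun t => h s' t - h s t) J ≤ ENNReal.ofReal (R s' - R s)
  abs_sub_le : ∀ t ∈ J, VariesBy (fun s => h s t) R I
  section_bv : ∀ s ∈ I, BoundedVariationOn (h s) J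

/-- Bounded variation in the sense of Hardy gives a control function: the variation, up to `s`, of
`s ↦ f (s, ·)` in the space of sections plus that of the horizontal section of bounded variation. -/
theorem IsBVOnRect.exists_hardyControl {f : ℝ × ℝ → ℝ} {a₁ b₁ a₂ b₂ : ℝ} (h₁ : a₁ < b₁)
    (h₂ : a₂ < b₂) (hf : IsBVOnRect f a₁ b₁ a₂ b₂) :
    ∃ R, HardyControl (fun s t => f (s, t)) R (Icc a₁ b₁) (Icc a₂ b₂) := by
  obtain ⟨C, hC⟩ := hf.bounded_sums
  obtain ⟨s₀, hs₀, hv⟩ := hf.vertical_section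
  obtain ⟨t₀, ht₀, hh⟩ := hf.horizontal_section
  let G : ℝ → SectionSpace (Icc a₂ b₂) := fun s t => f (s, t)
  have hG : BoundedVariationOn G (Icc a₁ b₁) := by
    refine ne_top_of_le_ne_top (ENNReal.ofReal_ne_top (r := C)) ?_
    have := sum_eVariationOn_le_of_isNet (Finset.univ : Finset Unit) (fun _ => G) h₁
      (C := ENNReal.ofReal C) fun m s hs => ?_
    · simpa using this
    · simp only [Finset.univ_unique, Finset.sum_const, Finset.card_singleton, one_smul,
        SectionSpace.edist_def]
      refine sum_eVariationOn_le_of_isNet _ (fun i t => G (s i) t - G (s (i + 1)) t) h₂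
        fun n t ht => ?_
      refine le_of_eq_of_le ?_ (ENNReal.ofReal_le_ofReal (hC m n s t hs ht))
      rw [ENNReal.ofReal_sum_of_nonneg fun _ _ => Finset.sum_nonneg fun _ _ => abs_nonneg _]
      refine Finset.sum_congr rfl fun i _ => ?_
      rw [ENNReal.ofReal_sum_of_nonneg fun _ _ => abs_nonneg _]
      refine Finset.sum_congr rfl fun j _ => ?_
      rw [edist_dist, Real.dist_eq]
      congr 2
      simp only [G, mixedDiff]
      ring
  have hGle : ∀ s ∈ Icc a₁ b₁, ∀ s' ∈ Icc a₁ b₁, s ≤ s' →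
      eVariationOn (fun t => f (s', t) - f (s, t)) (Icc a₂ b₂) ≤
        ENNReal.ofReal (variationOnFromTo G (Icc a₁ b₁) a₁ s' -
          variationOnFromTo G (Icc a₁ b₁) a₁ s) := fun s hs s' hs' hss' => by
    rw [← eVariationOn_eq_ofReal_variationOnFromTo hG hs hs' hss']
    exact eVariationOn.edist_le G (s := Icc a₁ b₁ ∩ Icc s s') ⟨hs', hss', le_rfl⟩ ⟨hs, le_rfl, hss'⟩
  have hGmono := variationOnFromTo.monotoneOn hG.locallyBoundedVariationOn
    (left_mem_Icc.2 h₁.le)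
  refine ⟨fun s => variationOnFromTo G (Icc a₁ b₁) a₁ s +
    variationOnFromTo (fun s => f (s, t₀)) (Icc a₁ b₁) a₁ s, ?_, ?_, ?_⟩
  · intro s hs s' hs' hss'
    refine (hGle s hs s' hs' hss').trans (ENNReal.ofReal_le_ofReal ?_)
    have := (abs_nonneg _).trans (hh.variesBy s hs s' hs' hss')
    linarith
  · intro t ht s hs s' hs' hss'
    have h1 := hh.variesBy s hs s' hs' hss'
    have h2 := (eVariationOn.edist_le (fun t => f (s', t) - f (s, t)) ht ht₀).trans
      (hGle s hs s' hs' hss')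
    rw [edist_dist, ENNReal.ofReal_le_ofReal_iff (sub_nonneg.2 (hGmono hs hs' hss')),
      Real.dist_eq] at h2
    have h1' := abs_le.1 h1
    have h2' := abs_le.1 h2
    simp only at h1' h2' ⊢
    rw [abs_le]
    constructor <;> linarith
  · -- each section is the one of bounded variation plus a difference of sections
    intro s hs
    have hdiff : eVariationOn (fun t => f (s, t) - f (s₀, t)) (Icc a₂ b₂) ≠ ⊤ := by
      rcases le_total s₀ s with h | h
      · exact ne_top_of_le_ne_top ENNReal.ofReal_ne_top (hGle s₀ hs₀ s hs h)
      · rw [eVariationOn_sub_comm]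
        exact ne_top_of_le_ne_top ENNReal.ofReal_ne_top (hGle s hs s₀ hs₀ h)
    have := eVariationOn_add_le (fun t => f (s₀, t)) (fun t => f (s, t) - f (s₀, t)) (Icc a₂ b₂)
    simp only [add_sub_cancel] at this
    exact ne_top_of_le_ne_top (ENNReal.add_ne_top.2 ⟨hv, hdiff⟩) this

namespace HardyControl

variable {h : ℝ → ℝ → ℝ} {R : ℝ → ℝ} {I J : Set ℝ}

theorem comp_fst_of_monotoneOn (H : HardyControl h R I J) {p : ℝ → ℝ} {I' : Set ℝ}
    (hp : MonotoneOn p I') (hI : MapsTo p I' I) :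
    HardyControl (fun s t => h (p s) t) (fun s => R (p s)) I' J where
  variation_le _ hs _ hs' hss' := H.variation_le _ (hI hs) _ (hI hs') (hp hs hs' hss')
  abs_sub_le t ht _ hs _ hs' hss' := H.abs_sub_le t ht _ (hI hs) _ (hI hs') (hp hs hs' hss')
  section_bv _ hs := H.section_bv _ (hI hs)

theorem comp_fst_of_antitoneOn (H : HardyControl h R I J) {p : ℝ → ℝ} {I' : Set ℝ}
    (hp : AntitoneOn p I') (hI : MapsTo p I' I) :
    HardyControl (fun s t => h (p s) t) (fun s => -R (p s)) I' J where
  variation_le s hs s' hs' hss' := by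
    rw [eVariationOn_sub_comm, neg_sub_neg]
    exact H.variation_le _ (hI hs') _ (hI hs) (hp hs hs' hss')
  abs_sub_le t ht s hs s' hs' hss' := by
    rw [abs_sub_comm, neg_sub_neg]
    exact H.abs_sub_le t ht _ (hI hs') _ (hI hs) (hp hs hs' hss')
  section_bv _ hs := H.section_bv _ (hI hs)

theorem comp_snd (H : HardyControl h R I J) {p : ℝ → ℝ} {J' : Set ℝ}
    (hp : MonotoneOn p J' ∨ AntitoneOn p J') (hJ : MapsTo p J' J) :
    HardyControl (fun s t => h s (p t)) R I J' := by
  have key : ∀ φ : ℝ → ℝ, eVariationOn (fun t => φ (p t)) J' ≤ eVariationOn φ J := fun φ =>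
    hp.elim (fun hp => eVariationOn.comp_le_of_monotoneOn φ p hp hJ)
      fun hp => eVariationOn.comp_le_of_antitoneOn φ p hp hJ
  exact
    { variation_le := fun s hs s' hs' hss' =>
        (key (fun t => h s' t - h s t)).trans (H.variation_le s hs s' hs' hss')
      abs_sub_le := fun t ht => H.abs_sub_le (p t) (hJ ht)
      section_bv := fun s hs => ne_top_of_le_ne_top (H.section_bv s hs) (key (h s)) }

theorem add {h' : ℝ → ℝ → ℝ} {R' : ℝ → ℝ} (hJ : J.Nonempty)
    (H : HardyControl h R I J) (H' : HardyControl h' R' I J) :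
    HardyControl (fun s t => h s t + h' s t) (fun s => R s + R' s) I J where
  variation_le s hs s' hs' hss' := by
    obtain ⟨t, ht⟩ := hJ
    have h1 := (abs_nonneg _).trans (H.abs_sub_le t ht s hs s' hs' hss')
    have h2 := (abs_nonneg _).trans (H'.abs_sub_le t ht s hs s' hs' hss')
    simp_rw [add_sub_add_comm]
    rw [ENNReal.ofReal_add h1 h2]
    exact (eVariationOn_add_le _ _ J).trans
      (add_le_add (H.variation_le s hs s' hs' hss') (H'.variation_le s hs s' hs' hss'))
  abs_sub_le t ht s hs s' hs' hss' := by
    simp only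
    rw [add_sub_add_comm, add_sub_add_comm]
    exact (abs_add_le _ _).trans
      (add_le_add (H.abs_sub_le t ht s hs s' hs' hss') (H'.abs_sub_le t ht s hs s' hs' hss'))
  section_bv s hs := ne_top_of_le_ne_top
    (ENNReal.add_ne_top.2 ⟨H.section_bv s hs, H'.section_bv s hs⟩)
    (eVariationOn_add_le (h s) (h' s) J)

variable {a b : ℝ}

theorem exists_tendsto_section (hb : 0 < b) (H : HardyControl h R I (Icc 0 b)) {s : ℝ}
    (hs : s ∈ I) : ∃ l, Tendsto (h s) (𝓝[>] 0) (𝓝 l) := by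
  obtain ⟨l, hl⟩ := (H.section_bv s hs).exists_tendsto_right 0
  refine ⟨l, hl.mono_left (nhdsWithin_le_of_mem ?_)⟩
  filter_upwards [Ioc_mem_nhdsGT hb] with t ht using ⟨⟨ht.1.le, ht.2⟩, ht.1⟩

/-- Existence of the corner limit: a section has a one-sided limit, and nearby sections are
uniformly close to it. -/
theorem exists_tendsto_corner (ha : 0 < a) (hb : 0 < b)
    (H : HardyControl h R (Icc 0 a) (Icc 0 b)) :
    ∃ l, Tendsto (fun p : ℝ × ℝ => h p.1 p.2) (𝓝[>] 0 ×ˢ 𝓝[>] 0) (𝓝 l) := by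
  rw [← cauchy_map_iff_exists_tendsto, Metric.cauchy_iff]
  refine ⟨inferInstance, fun ε hε => ?_⟩
  -- `R` is monotone and bounded below on `(0, a]`, hence has small oscillation near `0`
  have hR : MonotoneOn R (Icc 0 a) := (H.abs_sub_le 0 (left_mem_Icc.2 hb.le)).monotoneOn
  obtain ⟨δ, hδ, hosc⟩ : ∃ δ ∈ Ioc 0 a, ∀ s ∈ Ioc 0 δ, R δ - R s < ε / 6 := by
    have hbdd : BddBelow (R '' Ioc 0 a) := ⟨R 0, by
      rintro _ ⟨t, ht, rfl⟩
      exact hR (left_mem_Icc.2 ha.le) ⟨ht.1.le, ht.2⟩ ht.1.le⟩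
    obtain ⟨_, ⟨δ, hδ, rfl⟩, hlt⟩ := exists_lt_of_csInf_lt (⟨R a, a, ⟨ha, le_rfl⟩, rfl⟩ :
      (R '' Ioc 0 a).Nonempty)
      (lt_add_of_pos_right (sInf (R '' Ioc 0 a)) (by positivity : 0 < ε / 6))
    refine ⟨δ, hδ, fun s hs => ?_⟩
    have := csInf_le hbdd ⟨s, ⟨hs.1, hs.2.trans hδ.2⟩, rfl⟩
    linarith
  obtain ⟨l, hl⟩ := H.exists_tendsto_section hb ⟨hδ.1.le, hδ.2⟩
  have hev : ∀ᶠ p : ℝ × ℝ in 𝓝[>] 0 ×ˢ 𝓝[>] 0, dist (h p.1 p.2) l < ε / 3 := by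
    filter_upwards [(eventually_mem_set.2 (Ioc_mem_nhdsGT hδ.1)).prod_mk
      ((eventually_mem_set.2 (Ioc_mem_nhdsGT hb)).and
        (Metric.tendsto_nhds.1 hl (ε / 6) (by positivity)))] with ⟨s, t⟩ ⟨hs, ht, hd⟩
    simp only at hs ht hd ⊢
    have h1 := H.abs_sub_le t ⟨ht.1.le, ht.2⟩ s ⟨hs.1.le, hs.2.trans hδ.2⟩ δ ⟨hδ.1.le, hδ.2⟩ hs.2
    have h2 := hosc s hs
    have h3 := dist_triangle (h s t) (h δ t) l
    have h4 : dist (h s t) (h δ t) = |h δ t - h s t| := by rw [dist_comm, Real.dist_eq]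
    simp only at h1
    linarith
  refine ⟨Metric.ball l (ε / 3), hev, fun x hx y hy => ?_⟩
  have := dist_triangle_right x y l
  rw [Metric.mem_ball] at hx hy
  linarith

/-- The Dirichlet–Jordan theorem on a rectangle. The inner Dirichlet integrals are functions of
the outer variable which vary at most as much as a constant multiple of `R`, whatever the inner
frequency, so that the one-dimensional theorem for families applies to them. -/
theorem tendsto_integral (ha : 0 < a) (hb : 0 < b) (H : HardyControl h R (Icc 0 a) (Icc 0 b))
    {l : ℝ} (hl : Tendsto (fun p : ℝ × ℝ => h p.1 p.2) (𝓝[>] 0 ×ˢ 𝓝[>] 0) (𝓝 l)) :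
    Tendsto (fun p : ℝ × ℝ => ∫ s in (0 : ℝ)..a,
        (∫ t in (0 : ℝ)..b, h s t * (p.2 * Real.sinc (p.2 * t))) * (p.1 * Real.sinc (p.1 * s)))
      (atTop ×ˢ atTop) (𝓝 (l * (Real.pi / 2) ^ 2)) := by
  obtain ⟨B, hBpos, hB⟩ := exists_abs_sinIntegral_sub_le
  have hψ : ∀ s, ∃ ls, s ∈ Icc 0 a → Tendsto (h s) (𝓝[>] 0) (𝓝 ls) := fun s => by
    by_cases hs : s ∈ Icc 0 a
    · exact (H.exists_tendsto_section hb hs).imp fun _ hls _ => hls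
    · exact ⟨0, fun h => absurd h hs⟩
  choose ψ hψ using hψ
  -- the limits of the sections tend to the corner limit
  have hψl : Tendsto ψ (𝓝[>] 0) (𝓝 l) := by
    rw [Metric.tendsto_nhds]
    intro ε hε
    have hc := (Metric.tendsto_nhds.1 hl (ε / 2) (by positivity)).curry
    filter_upwards [hc, Ioc_mem_nhdsGT ha] with s hs hsa
    have := le_of_tendsto ((hψ s ⟨hsa.1.le, hsa.2⟩).dist tendsto_const_nhds)
      (hs.mono fun t ht => ht.le)
    linarith
  have hcont : ∀ N : ℝ, Continuous fun t => N * Real.sinc (N * t) := fun N => by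
    have := Real.continuous_sinc; fun_prop
  have hprim : ∀ N : ℝ, 0 ≤ N → ∀ u ∈ Icc 0 b, |∫ t in (0 : ℝ)..u, N * Real.sinc (N * t)| ≤ B :=
    fun N hN u hu => by
      rw [integral_mul_sinc_mul]
      exact hB _ _ (by simp) (mul_nonneg hN hu.1)
  have hV : ∀ {φ : ℝ → ℝ}, BoundedVariationOn φ (Icc 0 b) → ∀ t ∈ Ioc 0 b,
      0 ≤ variationOnFromTo φ (Icc 0 b) 0 t := fun _ t ht =>
    variationOnFromTo.nonneg_of_le _ _ ht.1.le
  have hvar : ∀ᶠ N : ℝ in atTop, VariesBy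
      (fun s => ∫ t in (0 : ℝ)..b, h s t * (N * Real.sinc (N * t))) (fun s => 4 * B * R s)
      (Ioc 0 a) := by
    filter_upwards [eventually_ge_atTop 0] with N hN s hs s' hs' hss'
    have hsI := Ioc_subset_Icc_self hs
    have hsI' := Ioc_subset_Icc_self hs'
    have int : ∀ s ∈ Icc 0 a, IntervalIntegrable (fun t => h s t * (N * Real.sinc (N * t)))
        volume 0 b := fun s hs =>
      (((H.section_bv s hs).variesBy.mono Ioc_subset_Icc_self).integral_mul hb
        (hV (H.section_bv s hs)) (hcont N) (hprim N hN)).1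
    simp only
    rw [← intervalIntegral.integral_sub (int s' hsI') (int s hsI)]
    have hle := H.variation_le s hsI s' hsI' hss'
    have hbv : BoundedVariationOn (fun t => h s' t - h s t) (Icc 0 b) :=
      ne_top_of_le_ne_top ENNReal.ofReal_ne_top hle
    obtain ⟨-, hbd⟩ := (hbv.variesBy.mono Ioc_subset_Icc_self).integral_mul hb (hV hbv)
      (hcont N) (hprim N hN)
    have habs := H.abs_sub_le b (right_mem_Icc.2 hb.le) s hsI s' hsI' hss'
    have hR0 : 0 ≤ R s' - R s := (abs_nonneg _).trans habs
    have htot : variationOnFromTo (fun t => h s' t - h s t) (Icc 0 b) 0 b ≤ R s' - R s := by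
      rw [variationOnFromTo.eq_of_le _ _ hb.le, inter_self]
      exact ENNReal.toReal_le_of_le_ofReal hR0 hle
    have hend : |(h s' b - h s b) * ∫ t in (0 : ℝ)..b, N * Real.sinc (N * t)| ≤
        (R s' - R s) * B := by
      rw [abs_mul]
      exact mul_le_mul habs (hprim N hN b (right_mem_Icc.2 hb.le)) (abs_nonneg _) hR0
    have hB3 : 3 * B * (variationOnFromTo (fun t => h s' t - h s t) (Icc 0 b) 0 b - 0) ≤
        3 * B * (R s' - R s) :=
      mul_le_mul_of_nonneg_left (by linarith) (by positivity)
    simp only [sub_mul] at hbd hend ⊢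
    have := abs_sub_abs_le_abs_sub (∫ t in (0 : ℝ)..b, (h s' t * (N * Real.sinc (N * t)) -
      h s t * (N * Real.sinc (N * t)))) ((h s' b * ∫ t in (0 : ℝ)..b, N * Real.sinc (N * t)) -
        h s b * ∫ t in (0 : ℝ)..b, N * Real.sinc (N * t))
    linarith
  have hlim : ∀ s ∈ Ioc 0 a, Tendsto
      (fun N : ℝ => ∫ t in (0 : ℝ)..b, h s t * (N * Real.sinc (N * t))) atTop
      (𝓝 (ψ s * (Real.pi / 2))) := fun s hs => by
    have hsI := Ioc_subset_Icc_self hs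
    have := tendsto_integral_mul_sinc (ι := Unit) (l := pure ()) (φ := fun _ => h s) (ψ := h s) hb
      (Eventually.of_forall fun _ => (H.section_bv s hsI).variesBy.mono Ioc_subset_Icc_self)
      (hV (H.section_bv s hsI)) (fun _ _ => tendsto_const_nhds) (hψ s hsI)
    exact this.comp (tendsto_id.prodMk tendsto_const_pure)
  have hR : MonotoneOn R (Icc 0 a) := (H.abs_sub_le 0 (left_mem_Icc.2 hb.le)).monotoneOn
  have := tendsto_integral_mul_sinc ha hvar (ρ := 4 * B * R 0)
    (fun s hs => by
      have := hR (left_mem_Icc.2 ha.le) (Ioc_subset_Icc_self hs) hs.1.le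
      gcongr) hlim (hψl.mul_const (Real.pi / 2))
  rwa [mul_assoc, ← pow_two] at this

end HardyControl

/-! ### The partial inverse Fourier integral as a Dirichlet integral over a quadrant -/

/-- The Dirichlet kernel of the Fourier integral, `sin (M t) / t` with the value `M` at `0`. -/
noncomputable def sineKernel (M t : ℝ) : ℝ := M * Real.sinc (M * t)

theorem continuous_sineKernel (M : ℝ) : Continuous (sineKernel M) := by
  have := Real.continuous_sinc
  unfold sineKernel
  fun_prop

theorem sineKernel_neg (M t : ℝ) : sineKernel M (-t) = sineKernel M t := by
  simp [sineKernel]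

theorem abs_sineKernel_le (M t : ℝ) : |sineKernel M t| ≤ |M| := by
  rw [sineKernel, abs_mul]
  exact mul_le_of_le_one_right (abs_nonneg _) (Real.abs_sinc_le_one _)

theorem integral_exp_eq_sineKernel (M c : ℝ) :
    ∫ u in (-M)..M, Complex.exp (Complex.I * u * c) = ((2 * sineKernel M c : ℝ) : ℂ) := by
  have e : ∀ u : ℝ, Complex.exp (Complex.I * u * c) =
      (fun t : ℝ => Complex.exp (t * Complex.I)) (u * c) := fun u => by
    simp only [Complex.ofReal_mul]
    ring_nf
  simp_rw [e]
  rcases eq_or_ne c 0 with rfl | hc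
  · simp [sineKernel]; ring
  · rw [intervalIntegral.integral_comp_mul_right (fun t : ℝ => Complex.exp (t * Complex.I)) hc,
      neg_mul, integral_exp_mul_I_eq_sinc]
    have : (c : ℂ) ≠ 0 := by exact_mod_cast hc
    simp only [sineKernel, Complex.real_smul]
    push_cast
    field_simp

theorem integral_integral_mul_exp {k : ℝ × ℝ → ℂ} (hk : Integrable k) {c : ℝ × ℝ → ℝ}
    (hc : Continuous c) (M : ℝ) :
    ∫ u in (-M)..M, ∫ p, k p * Complex.exp (Complex.I * u * c p) =
      ∫ p, k p * ((2 * sineKernel M (c p) : ℝ) : ℂ) := by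
  rw [intervalIntegral_integral_swap]
  · simp_rw [intervalIntegral.integral_const_mul, integral_exp_eq_sineKernel]
  · have : IsFiniteMeasure (volume.restrict (uIoc (-M) M)) := by unfold uIoc; infer_instance
    have h1 : Integrable (fun q : ℝ × (ℝ × ℝ) => k q.2)
        ((volume.restrict (uIoc (-M) M)).prod volume) := hk.comp_snd _
    refine h1.mul_bdd (c := 1) (Continuous.aestronglyMeasurable (by fun_prop))
      (ae_of_all _ fun q => ?_)
    rw [mul_assoc, ← Complex.ofReal_mul, Complex.norm_exp_I_mul_ofReal]

theorem partialInverse_eq_integral {f : ℝ × ℝ → ℝ} (hf : Integrable f) (x₀ y₀ M N : ℝ) :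
    partialInverse f x₀ y₀ M N = ((1 / Real.pi ^ 2 *
      ∫ q : ℝ × ℝ, f (x₀ + q.1, y₀ + q.2) * (sineKernel M q.1 * sineKernel N q.2) : ℝ) : ℂ) := by
  have hfc : Integrable (fun p => (f p : ℂ)) := hf.ofReal
  have e : ∀ u v : ℝ, fourier2 f u v * Complex.exp (Complex.I * u * x₀) *
      Complex.exp (Complex.I * v * y₀) = ∫ p : ℝ × ℝ, ((f p : ℂ) *
        Complex.exp (Complex.I * v * ((y₀ - p.2 : ℝ) : ℂ))) *
          Complex.exp (Complex.I * u * ((x₀ - p.1 : ℝ) : ℂ)) := fun u v => by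
    unfold fourier2
    rw [← integral_mul_const, ← integral_mul_const]
    refine integral_congr_ae (ae_of_all _ fun p => ?_)
    simp only [mul_assoc, ← Complex.exp_add]
    push_cast
    ring_nf
  have hk1 : ∀ v : ℝ, Integrable (fun p : ℝ × ℝ => (f p : ℂ) *
      Complex.exp (Complex.I * v * ((y₀ - p.2 : ℝ) : ℂ))) := fun v => by
    refine hfc.mul_bdd (c := 1) (Continuous.aestronglyMeasurable (by fun_prop))
      (ae_of_all _ fun p => ?_)
    rw [mul_assoc, ← Complex.ofReal_mul, Complex.norm_exp_I_mul_ofReal]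
  have hk2 : Integrable (fun p : ℝ × ℝ => (f p : ℂ) * ((2 * sineKernel M (x₀ - p.1) : ℝ) : ℂ)) := by
    have := continuous_sineKernel M
    refine hfc.mul_bdd (c := 2 * |M|) (Continuous.aestronglyMeasurable (by fun_prop))
      (ae_of_all _ fun p => ?_)
    rw [Complex.norm_real, Real.norm_eq_abs, abs_mul, abs_two]
    exact mul_le_mul_of_nonneg_left (abs_sineKernel_le _ _) zero_le_two
  unfold partialInverse
  simp_rw [e, integral_integral_mul_exp (hk1 _)
    (by fun_prop : Continuous fun p : ℝ × ℝ => x₀ - p.1)]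
  have e2 : ∀ v : ℝ, (∫ p : ℝ × ℝ, (f p : ℂ) *
      Complex.exp (Complex.I * v * ((y₀ - p.2 : ℝ) : ℂ)) *
        ((2 * sineKernel M (x₀ - p.1) : ℝ) : ℂ)) =
      ∫ p : ℝ × ℝ, ((f p : ℂ) * ((2 * sineKernel M (x₀ - p.1) : ℝ) : ℂ)) *
        Complex.exp (Complex.I * v * ((y₀ - p.2 : ℝ) : ℂ)) := fun v =>
    integral_congr_ae (ae_of_all _ fun p => mul_right_comm _ _ _)
  simp_rw [e2, integral_integral_mul_exp hk2 (by fun_prop : Continuous fun p : ℝ × ℝ => y₀ - p.2)]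
  rw [← integral_add_left_eq_self _ ((x₀, y₀) : ℝ × ℝ), Complex.ofReal_mul,
    ← integral_complex_ofReal, ← integral_const_mul, ← integral_const_mul]
  refine integral_congr_ae (ae_of_all _ fun q => ?_)
  have h1 : x₀ - (x₀ + q.1) = - q.1 := by ring
  have h2 : y₀ - (y₀ + q.2) = - q.2 := by ring
  have h3 : (x₀, y₀) + q = (x₀ + q.1, y₀ + q.2) := rfl
  simp only [h3, h1, h2, sineKernel_neg]
  push_cast
  have hpi : (Real.pi : ℂ) ≠ 0 := by exact_mod_cast Real.pi_ne_zero
  field_simp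
  ring

/-- Folding an integral along an involution `e` which exchanges, within `T`, the set `S` and its
complement. -/
theorem setIntegral_eq_of_involutive {α : Type*} [MeasurableSpace α] {μ : Measure α} {e : α → α}
    (he : MeasurePreserving e μ μ) (hinv : Function.Involutive e) {S T : Set α}
    (hS : MeasurableSet S) (hT : e ⁻¹' T = T) (hSc : (e ⁻¹' S : Set α) =ᵐ[μ] (Sᶜ : Set α))
    {G : α → ℝ} (hG : Integrable G μ) :
    ∫ x in T, G x ∂μ = ∫ x in T ∩ S, (G x + G (e x)) ∂μ := by
  have hemb : MeasurableEmbedding e :=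
    (MeasurableEquiv.mk hinv.toPerm he.measurable he.measurable).measurableEmbedding
  have hG' : Integrable (fun x => G (e x)) μ := (he.integrable_comp_emb hemb).2 hG
  rw [← integral_inter_add_sdiff hS hG.integrableOn, integral_add hG.integrableOn hG'.integrableOn]
  congr 1
  have hee : ∀ x, e (e x) = x := hinv
  have h1 : (T \ S : Set α) =ᵐ[μ] (e ⁻¹' (T ∩ S) : Set α) := by
    rw [preimage_inter, hT, sdiff_eq]
    exact (ae_eq_refl T).inter hSc.symm
  rw [setIntegral_congr_set h1, ← he.setIntegral_preimage_emb hemb (fun x => G (e x))]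
  simp only [hee]

theorem integral_eq_setIntegral_quadrant {G : ℝ × ℝ → ℝ} (hG : Integrable G) :
    ∫ p, G p = ∫ p in Ioi 0 ×ˢ Ioi 0,
      (G p + G (-p.1, p.2) + (G (p.1, -p.2) + G (-p.1, -p.2))) := by
  have hneg := Measure.measurePreserving_neg (volume : Measure ℝ)
  have h1 : MeasurePreserving (fun p : ℝ × ℝ => (-p.1, p.2)) volume volume :=
    hneg.prod (MeasurePreserving.id volume)
  have h2 : MeasurePreserving (fun p : ℝ × ℝ => (p.1, -p.2)) volume volume :=
    (MeasurePreserving.id volume).prod hneg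
  have i1 : Integrable (fun p : ℝ × ℝ => G (-p.1, p.2)) :=
    (h1.integrable_comp_emb (MeasurableEquiv.mk (Function.Involutive.toPerm _
      (fun p : ℝ × ℝ => by simp)) h1.measurable h1.measurable).measurableEmbedding).2 hG
  rw [← setIntegral_univ, setIntegral_eq_of_involutive h1 (fun p => by simp)
    (S := {p | 0 < p.1}) (measurableSet_lt measurable_const measurable_fst) rfl ?_ hG, univ_inter,
    setIntegral_eq_of_involutive h2 (fun p => by simp) (S := {p | 0 < p.2}) (T := {p | 0 < p.1})
      (measurableSet_lt measurable_const measurable_snd) rfl ?_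
      (G := fun p => G p + G (-p.1, p.2)) (hG.add i1)]
  · rfl
  · have : ∀ᵐ p : ℝ × ℝ, p.2 ≠ 0 :=
      Measure.quasiMeasurePreserving_snd.ae (Measure.ae_ne volume (0 : ℝ))
    filter_upwards [this] with p hp
    refine propext ?_
    change (0 < -p.2) ↔ ¬ (0 < p.2)
    rw [not_lt, neg_pos]
    exact ⟨le_of_lt, fun h => lt_of_le_of_ne h hp⟩
  · have : ∀ᵐ p : ℝ × ℝ, p.1 ≠ 0 :=
      Measure.quasiMeasurePreserving_fst.ae (Measure.ae_ne volume (0 : ℝ))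
    filter_upwards [this] with p hp
    refine propext ?_
    change (0 < -p.1) ↔ ¬ (0 < p.1)
    rw [not_lt, neg_pos]
    exact ⟨le_of_lt, fun h => lt_of_le_of_ne h hp⟩

theorem integrable_mul_sineKernel {G : ℝ × ℝ → ℝ} {μ : Measure (ℝ × ℝ)} (hG : Integrable G μ)
    (M N : ℝ) : Integrable (fun q => G q * (sineKernel M q.1 * sineKernel N q.2)) μ := by
  have h1 := continuous_sineKernel M
  have h2 := continuous_sineKernel N
  refine hG.mul_bdd (c := |M| * |N|) (Continuous.aestronglyMeasurable (by fun_prop))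
    (ae_of_all _ fun q => ?_)
  rw [Real.norm_eq_abs, abs_mul]
  exact mul_le_mul (abs_sineKernel_le _ _) (abs_sineKernel_le _ _) (abs_nonneg _) (abs_nonneg _)

theorem partialInverse_eq_setIntegral_symmSum {f : ℝ × ℝ → ℝ} (hf : Integrable f)
    (x₀ y₀ M N : ℝ) :
    partialInverse f x₀ y₀ M N = ((1 / Real.pi ^ 2 * ∫ q in Ioi (0 : ℝ) ×ˢ Ioi (0 : ℝ),
      symmSum f x₀ y₀ q.1 q.2 * (sineKernel M q.1 * sineKernel N q.2) : ℝ) : ℂ) := by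
  rw [partialInverse_eq_integral hf, integral_eq_setIntegral_quadrant
    (integrable_mul_sineKernel (G := fun q => f (x₀ + q.1, y₀ + q.2))
      (hf.comp_add_left ((x₀, y₀) : ℝ × ℝ)) M N)]
  congr 3
  funext q
  simp only [sineKernel_neg, symmSum, ← sub_eq_add_neg]
  ring

theorem integrable_symmSum {f : ℝ × ℝ → ℝ} (hf : Integrable f) (x₀ y₀ : ℝ) :
    Integrable (fun q : ℝ × ℝ => symmSum f x₀ y₀ q.1 q.2) := by
  have hneg := Measure.measurePreserving_neg (volume : Measure ℝ)
  have hid := MeasurePreserving.id (volume : Measure ℝ)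
  have hadd : Integrable (fun q : ℝ × ℝ => f (x₀ + q.1, y₀ + q.2)) :=
    hf.comp_add_left ((x₀, y₀) : ℝ × ℝ)
  have h1 := (hneg.prod hneg).integrable_comp_of_integrable hadd
  have h2 := (hneg.prod hid).integrable_comp_of_integrable hadd
  have h3 := (hid.prod hneg).integrable_comp_of_integrable hadd
  refine (((h1.add hadd).add h2).add h3).congr (ae_of_all _ fun q => ?_)
  simp [symmSum, sub_eq_add_neg]

/-! ### The contribution away from the singular point -/

/-- A two-dimensional Riemann–Lebesgue lemma, for two frequencies tending to infinity
independently: the inner integral already tends to zero, whatever the outer frequency. -/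
theorem tendsto_integral_mul_sin_mul_sin {k : ℝ × ℝ → ℝ} (hk : Integrable k) :
    Tendsto (fun p : ℝ × ℝ => ∫ q, k q * (Real.sin (p.1 * q.1) * Real.sin (p.2 * q.2)))
      (atTop ×ˢ atTop) (𝓝 0) := by
  have hint : ∀ N : ℝ, Integrable (fun q : ℝ × ℝ => k q * Real.sin (N * q.2)) := fun N =>
    hk.mul_bdd (c := 1) (Continuous.aestronglyMeasurable (by fun_prop))
      (ae_of_all _ fun q => Real.abs_sin_le_one _)
  have hinner : Tendsto (fun N : ℝ => ∫ s, |∫ t, k (s, t) * Real.sin (N * t)|) atTop (𝓝 0) := by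
    have := tendsto_integral_filter_of_dominated_convergence (μ := (volume : Measure ℝ))
      (l := (atTop : Filter ℝ)) (F := fun N s => |∫ t, k (s, t) * Real.sin (N * t)|)
      (f := fun _ => 0) (fun s => ∫ t, ‖k (s, t)‖)
      (Eventually.of_forall fun N => (hint N).integral_prod_left.aestronglyMeasurable.norm)
      (Eventually.of_forall fun N => ?_) hk.integral_norm_prod_left ?_
    · simpa using this
    · filter_upwards [hk.prod_right_ae] with s hs
      rw [Real.norm_eq_abs, abs_abs, ← Real.norm_eq_abs]
      refine norm_integral_le_of_norm_le hs.norm (ae_of_all _ fun t => ?_)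
      rw [norm_mul]
      exact mul_le_of_le_one_right (norm_nonneg _) (Real.abs_sin_le_one _)
    · filter_upwards [hk.prod_right_ae] with s hs
      simpa using (tendsto_integral_mul_sin hs).abs
  refine squeeze_zero_norm (fun p => ?_) (hinner.comp tendsto_snd)
  have hint2 : Integrable (fun q : ℝ × ℝ =>
      k q * (Real.sin (p.1 * q.1) * Real.sin (p.2 * q.2))) := by
    refine hk.mul_bdd (c := 1) (Continuous.aestronglyMeasurable (by fun_prop))
      (ae_of_all _ fun q => ?_)
    rw [Real.norm_eq_abs, abs_mul]
    exact mul_le_one₀ (Real.abs_sin_le_one _) (abs_nonneg _) (Real.abs_sin_le_one _)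
  rw [Measure.volume_eq_prod, integral_prod _ hint2]
  refine norm_integral_le_of_norm_le (hint p.2).integral_prod_left.norm (ae_of_all _ fun s => ?_)
  have e : ∀ t, k (s, t) * (Real.sin (p.1 * s) * Real.sin (p.2 * t)) =
      Real.sin (p.1 * s) * (k (s, t) * Real.sin (p.2 * t)) := fun t => by ring
  simp_rw [e, integral_const_mul]
  rw [norm_mul]
  exact mul_le_of_le_one_left (norm_nonneg _) (Real.abs_sin_le_one _)

theorem tendsto_setIntegral_mul_sin_mul_sin {k : ℝ × ℝ → ℝ} {S : Set (ℝ × ℝ)}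
    (hS : MeasurableSet S) (hk : IntegrableOn k S) :
    Tendsto (fun p : ℝ × ℝ => ∫ q in S, k q * (Real.sin (p.1 * q.1) * Real.sin (p.2 * q.2)))
      (atTop ×ˢ atTop) (𝓝 0) := by
  refine (tendsto_integral_mul_sin_mul_sin (hk.integrable_indicator hS)).congr fun p => ?_
  rw [← integral_indicator hS]
  exact integral_congr_ae (ae_of_all _ fun t => by by_cases h : t ∈ S <;> simp [h])

/-- Away from both axes the kernels are not singular. -/
theorem tendsto_setIntegral_far {G : ℝ → ℝ → ℝ} (hG : Integrable (fun q : ℝ × ℝ => G q.1 q.2))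
    {ε₁ ε₂ : ℝ} (hε₁ : 0 < ε₁) (hε₂ : 0 < ε₂) :
    Tendsto (fun p : ℝ × ℝ => ∫ q in Ioi ε₁ ×ˢ Ioi ε₂,
      G q.1 q.2 * (sineKernel p.1 q.1 * sineKernel p.2 q.2)) (atTop ×ˢ atTop) (𝓝 0) := by
  have hS : MeasurableSet (Ioi ε₁ ×ˢ Ioi ε₂) := measurableSet_Ioi.prod measurableSet_Ioi
  have hk : IntegrableOn (fun q : ℝ × ℝ => G q.1 q.2 * (q.1⁻¹ * q.2⁻¹)) (Ioi ε₁ ×ˢ Ioi ε₂) := by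
    refine hG.integrableOn.mul_bdd (c := ε₁⁻¹ * ε₂⁻¹)
      (Measurable.aestronglyMeasurable (by fun_prop)) ?_
    filter_upwards [ae_restrict_mem hS] with q hq
    have h1 : ε₁ < q.1 := hq.1
    have h2 : ε₂ < q.2 := hq.2
    have p1 := hε₁.trans h1
    have p2 := hε₂.trans h2
    rw [Real.norm_eq_abs, abs_of_pos (by positivity)]
    gcongr
  refine (tendsto_setIntegral_mul_sin_mul_sin hS hk).congr fun p => ?_
  refine setIntegral_congr_fun hS fun q hq => ?_
  have h1 : q.1 ≠ 0 := (hε₁.trans hq.1).ne'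
  have h2 : q.2 ≠ 0 := (hε₂.trans hq.2).ne'
  simp only [sineKernel, mul_sinc_mul h1, mul_sinc_mul h2]
  field_simp

/-- The strip on which the first kernel is singular and the second one is not: subtracting the
section `G c` makes the quotient by the first variable integrable, and the subtracted product
splits into two one-dimensional integrals. -/
theorem tendsto_setIntegral_strip {G : ℝ → ℝ → ℝ} (hG : Integrable (fun q : ℝ × ℝ => G q.1 q.2))
    {ε₁ ε₂ c : ℝ} (hε₁ : 0 < ε₁) (hε₂ : 0 < ε₂) (hc : Integrable (G c))
    (hLC : ∫⁻ t in Ioi ε₂, ∫⁻ s in Ioc 0 ε₁, ENNReal.ofReal |(G s t - G c t) / s| < ⊤) :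
    Tendsto (fun p : ℝ × ℝ => ∫ q in Ioc 0 ε₁ ×ˢ Ioi ε₂,
      G q.1 q.2 * (sineKernel p.1 q.1 * sineKernel p.2 q.2)) (atTop ×ˢ atTop) (𝓝 0) := by
  have hS : MeasurableSet (Ioc 0 ε₁ ×ˢ Ioi ε₂) := measurableSet_Ioc.prod measurableSet_Ioi
  have hvol : (volume : Measure (ℝ × ℝ)).restrict (Ioc 0 ε₁ ×ˢ Ioi ε₂) =
      (volume.restrict (Ioc 0 ε₁)).prod (volume.restrict (Ioi ε₂)) :=
    (Measure.prod_restrict _ _).symm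
  have hmeas : AEStronglyMeasurable (fun q : ℝ × ℝ => (G q.1 q.2 - G c q.2) / q.1) :=
    (hG.aestronglyMeasurable.sub hc.aestronglyMeasurable.comp_snd).mul
      (Measurable.aestronglyMeasurable (f := fun q : ℝ × ℝ => q.1⁻¹) (by fun_prop))
  have hquot : IntegrableOn (fun q : ℝ × ℝ => (G q.1 q.2 - G c q.2) / q.1)
      (Ioc 0 ε₁ ×ˢ Ioi ε₂) := by
    refine ⟨hmeas.restrict, ?_⟩
    rw [hasFiniteIntegral_iff_norm, hvol, lintegral_prod_symm]
    · exact hLC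
    · rw [← hvol]
      exact hmeas.restrict.norm.aemeasurable.ennreal_ofReal
  have hk : IntegrableOn (fun q : ℝ × ℝ => (G q.1 q.2 - G c q.2) / q.1 * q.2⁻¹)
      (Ioc 0 ε₁ ×ˢ Ioi ε₂) := by
    refine hquot.mul_bdd (c := ε₂⁻¹) (Measurable.aestronglyMeasurable (by fun_prop)) ?_
    filter_upwards [ae_restrict_mem hS] with q hq
    have h2 : ε₂ < q.2 := hq.2
    have p2 := hε₂.trans h2
    rw [Real.norm_eq_abs, abs_of_pos (by positivity)]
    gcongr
  have hkc : IntegrableOn (fun t => G c t * t⁻¹) (Ioi ε₂) := by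
    refine hc.integrableOn.mul_bdd (c := ε₂⁻¹) (Measurable.aestronglyMeasurable (by fun_prop)) ?_
    filter_upwards [ae_restrict_mem measurableSet_Ioi] with t ht
    have p2 := hε₂.trans ht
    rw [Real.norm_eq_abs, abs_of_pos (by positivity)]
    exact inv_anti₀ hε₂ (le_of_lt ht)
  have hprod : Tendsto (fun p : ℝ × ℝ => sinIntegral (p.1 * ε₁) *
      ∫ t in Ioi ε₂, G c t * t⁻¹ * Real.sin (p.2 * t)) (atTop ×ˢ atTop) (𝓝 0) := by
    have h1 := (tendsto_sinIntegral.comp (tendsto_id.atTop_mul_const hε₁)).comp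
      (tendsto_fst (f := atTop) (g := (atTop : Filter ℝ)))
    have h2 := (tendsto_setIntegral_mul_sin measurableSet_Ioi hkc).comp
      (tendsto_snd (f := (atTop : Filter ℝ)) (g := atTop))
    have := h1.mul h2
    rw [mul_zero] at this
    exact this
  have hsum := (tendsto_setIntegral_mul_sin_mul_sin hS hk).add hprod
  rw [add_zero] at hsum
  refine hsum.congr fun p => ?_
  have hker : sinIntegral (p.1 * ε₁) = ∫ s in Ioc 0 ε₁, sineKernel p.1 s := by
    rw [← intervalIntegral.integral_of_le hε₁.le]
    unfold sineKernel
    rw [integral_mul_sinc_mul]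
    simp [sinIntegral]
  have i1 : IntegrableOn (fun q : ℝ × ℝ => sineKernel p.1 q.1 *
      (G c q.2 * q.2⁻¹ * Real.sin (p.2 * q.2))) (Ioc 0 ε₁ ×ˢ Ioi ε₂) := by
    rw [IntegrableOn, hvol]
    refine Integrable.mul_prod (f := sineKernel p.1)
      (g := fun t => G c t * t⁻¹ * Real.sin (p.2 * t)) ?_ ?_
    · exact ((continuous_sineKernel p.1).integrableOn_Icc).mono_set Ioc_subset_Icc_self
    · exact hkc.mul_bdd (c := 1) (Continuous.aestronglyMeasurable (by fun_prop))
        (ae_of_all _ fun t => Real.abs_sin_le_one _)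
  have i2 : IntegrableOn (fun q : ℝ × ℝ => (G q.1 q.2 - G c q.2) / q.1 * q.2⁻¹ *
      (Real.sin (p.1 * q.1) * Real.sin (p.2 * q.2))) (Ioc 0 ε₁ ×ˢ Ioi ε₂) := by
    refine hk.mul_bdd (c := 1) (Continuous.aestronglyMeasurable (by fun_prop))
      (ae_of_all _ fun q => ?_)
    rw [Real.norm_eq_abs, abs_mul]
    exact mul_le_one₀ (Real.abs_sin_le_one _) (abs_nonneg _) (Real.abs_sin_le_one _)
  rw [hker, ← integral_prod_mul (sineKernel p.1) (fun t => G c t * t⁻¹ * Real.sin (p.2 * t)),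
    ← hvol, ← integral_add i2 i1]
  refine setIntegral_congr_fun hS fun q hq => ?_
  have h1 : q.1 ≠ 0 := hq.1.1.ne'
  have h2 : q.2 ≠ 0 := (hε₂.trans hq.2).ne'
  simp only [sineKernel, mul_sinc_mul h1, mul_sinc_mul h2]
  field_simp
  ring

theorem setIntegral_quadrant_eq_add {H : ℝ × ℝ → ℝ} (hH : Integrable H) {ε₁ ε₂ : ℝ}
    (hε₁ : 0 < ε₁) (hε₂ : 0 < ε₂) :
    ∫ q in Ioi 0 ×ˢ Ioi 0, H q =
      ((∫ q in Ioc 0 ε₁ ×ˢ Ioc 0 ε₂, H q) + ∫ q in Ioc 0 ε₁ ×ˢ Ioi ε₂, H q) +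
        ((∫ q in Ioi ε₁ ×ˢ Ioc 0 ε₂, H q) + ∫ q in Ioi ε₁ ×ˢ Ioi ε₂, H q) := by
  have hsplit : ∀ A : Set ℝ, MeasurableSet A → ∫ q in A ×ˢ Ioi 0, H q =
      (∫ q in A ×ˢ Ioc 0 ε₂, H q) + ∫ q in A ×ˢ Ioi ε₂, H q := fun A hA => by
    rw [← setIntegral_union _ (hA.prod measurableSet_Ioi) hH.integrableOn hH.integrableOn,
      ← prod_union, Ioc_union_Ioi_eq_Ioi hε₂.le]
    exact Disjoint.set_prod_right Ioc_disjoint_Ioi_same _ _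
  rw [← hsplit _ measurableSet_Ioc, ← hsplit _ measurableSet_Ioi,
    ← setIntegral_union _ (measurableSet_Ioi.prod measurableSet_Ioi) hH.integrableOn
      hH.integrableOn, ← union_prod, Ioc_union_Ioi_eq_Ioi hε₁.le]
  exact Disjoint.set_prod_left Ioc_disjoint_Ioi_same _ _

/-- The contribution of the rectangle at the singular point, as an integral over the plane. -/
theorem HardyControl.tendsto_setIntegral_sineKernel {h : ℝ → ℝ → ℝ} {R : ℝ → ℝ} {a b : ℝ}
    (ha : 0 < a) (hb : 0 < b) (H : HardyControl h R (Icc 0 a) (Icc 0 b))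
    (hint : Integrable (fun q : ℝ × ℝ => h q.1 q.2))
    {l : ℝ} (hl : Tendsto (fun p : ℝ × ℝ => h p.1 p.2) (𝓝[>] 0 ×ˢ 𝓝[>] 0) (𝓝 l)) :
    Tendsto (fun p : ℝ × ℝ => ∫ q in Ioc 0 a ×ˢ Ioc 0 b,
      h q.1 q.2 * (sineKernel p.1 q.1 * sineKernel p.2 q.2))
      (atTop ×ˢ atTop) (𝓝 (l * (Real.pi / 2) ^ 2)) := by
  refine (H.tendsto_integral ha hb hl).congr fun p => ?_
  rw [Measure.volume_eq_prod, setIntegral_prod, intervalIntegral.integral_of_le ha.le]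
  · refine setIntegral_congr_fun measurableSet_Ioc fun s _ => ?_
    simp only
    rw [← intervalIntegral.integral_mul_const, intervalIntegral.integral_of_le hb.le]
    refine setIntegral_congr_fun measurableSet_Ioc fun t _ => ?_
    simp only [sineKernel]
    ring
  · exact (integrable_mul_sineKernel hint p.1 p.2).integrableOn

end FourierInversion2D

/-! ### The inversion theorem -/

open FourierInversion2D in
theorem theorem3p1 (f : ℝ × ℝ → ℝ) (hf : Integrable f) (x₀ y₀ ε₁ ε₂ : ℝ)
    (hε₁ : 0 < ε₁) (hε₂ : 0 < ε₂)
    (hBV : FourierInversion2D.IsBVIn f (FourierInversion2D.cross x₀ y₀ ε₁ ε₂))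
    (hLC : FourierInversion2D.IsLC f x₀ y₀ ε₁ ε₂) :
    ∃ fpp fpm fmp fmm : ℝ,
      Tendsto f (𝓝[>] x₀ ×ˢ 𝓝[>] y₀) (𝓝 fpp) ∧
      Tendsto f (𝓝[>] x₀ ×ˢ 𝓝[<] y₀) (𝓝 fpm) ∧
      Tendsto f (𝓝[<] x₀ ×ˢ 𝓝[>] y₀) (𝓝 fmp) ∧
      Tendsto f (𝓝[<] x₀ ×ˢ 𝓝[<] y₀) (𝓝 fmm) ∧
      Tendsto (fun p : ℝ × ℝ => FourierInversion2D.partialInverse f x₀ y₀ p.1 p.2)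
        (atTop ×ˢ atTop) (𝓝 (((fpp + fpm + fmp + fmm) / 4 : ℝ) : ℂ)) ∧
      (ContinuousAt f (x₀, y₀) → (fpp + fpm + fmp + fmm) / 4 = f (x₀, y₀)) := by
  have hrect : Icc (x₀ - ε₁) (x₀ + ε₁) ×ˢ Icc (y₀ - ε₂) (y₀ + ε₂) ⊆ cross x₀ y₀ ε₁ ε₂ :=
    fun p hp => Or.inl (abs_le.2 ⟨by linarith [hp.1.1], by linarith [hp.1.2]⟩)
  obtain ⟨R, H⟩ := (hBV _ _ _ _ (by linarith) (by linarith) hrect).exists_hardyControl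
    (by linarith) (by linarith)
  have addMono : ∀ z ε : ℝ, MonotoneOn (fun s => z + s) (Icc 0 ε) := fun z ε s _ t _ hst => by
    simpa using hst
  have subAnti : ∀ z ε : ℝ, AntitoneOn (fun s => z - s) (Icc 0 ε) := fun z ε s _ t _ hst =>
    sub_le_sub_left hst z
  have addMaps : ∀ z ε : ℝ, MapsTo (fun s => z + s) (Icc 0 ε) (Icc (z - ε) (z + ε)) :=
    fun z ε s hs => ⟨by linarith [hs.1, hs.2], by linarith [hs.1, hs.2]⟩
  have subMaps : ∀ z ε : ℝ, MapsTo (fun s => z - s) (Icc 0 ε) (Icc (z - ε) (z + ε)) :=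
    fun z ε s hs => ⟨by linarith [hs.1, hs.2], by linarith [hs.1, hs.2]⟩
  have Hp := H.comp_fst_of_monotoneOn (addMono x₀ ε₁) (addMaps x₀ ε₁)
  have Hm := H.comp_fst_of_antitoneOn (subAnti x₀ ε₁) (subMaps x₀ ε₁)
  have Hpp := Hp.comp_snd (Or.inl (addMono y₀ ε₂)) (addMaps y₀ ε₂)
  have Hpm := Hp.comp_snd (Or.inr (subAnti y₀ ε₂)) (subMaps y₀ ε₂)
  have Hmp := Hm.comp_snd (Or.inl (addMono y₀ ε₂)) (addMaps y₀ ε₂)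
  have Hmm := Hm.comp_snd (Or.inr (subAnti y₀ ε₂)) (subMaps y₀ ε₂)
  obtain ⟨fpp, hpp⟩ := Hpp.exists_tendsto_corner hε₁ hε₂
  obtain ⟨fpm, hpm⟩ := Hpm.exists_tendsto_corner hε₁ hε₂
  obtain ⟨fmp, hmp⟩ := Hmp.exists_tendsto_corner hε₁ hε₂
  obtain ⟨fmm, hmm⟩ := Hmm.exists_tendsto_corner hε₁ hε₂
  have right : ∀ z : ℝ, Tendsto (fun s => s - z) (𝓝[>] z) (𝓝[>] 0) := fun z =>
    tendsto_nhdsWithin_iff.2 ⟨((continuous_id.sub continuous_const).tendsto' z 0 (sub_self z)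
      ).mono_left nhdsWithin_le_nhds, by
        filter_upwards [self_mem_nhdsWithin] with s hs using sub_pos.2 (mem_Ioi.1 hs)⟩
  have left : ∀ z : ℝ, Tendsto (fun s => z - s) (𝓝[<] z) (𝓝[>] 0) := fun z =>
    tendsto_nhdsWithin_iff.2 ⟨((continuous_const.sub continuous_id).tendsto' z 0 (sub_self z)
      ).mono_left nhdsWithin_le_nhds, by
        filter_upwards [self_mem_nhdsWithin] with s hs using sub_pos.2 (mem_Iio.1 hs)⟩
  have tpp : Tendsto f (𝓝[>] x₀ ×ˢ 𝓝[>] y₀) (𝓝 fpp) := by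
    simpa [Function.comp_def] using hpp.comp ((right x₀).prodMap (right y₀))
  have tpm : Tendsto f (𝓝[>] x₀ ×ˢ 𝓝[<] y₀) (𝓝 fpm) := by
    simpa [Function.comp_def] using hpm.comp ((right x₀).prodMap (left y₀))
  have tmp : Tendsto f (𝓝[<] x₀ ×ˢ 𝓝[>] y₀) (𝓝 fmp) := by
    simpa [Function.comp_def] using hmp.comp ((left x₀).prodMap (right y₀))
  have tmm : Tendsto f (𝓝[<] x₀ ×ˢ 𝓝[<] y₀) (𝓝 fmm) := by
    simpa [Function.comp_def] using hmm.comp ((left x₀).prodMap (left y₀))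
  refine ⟨fpp, fpm, fmp, fmm, tpp, tpm, tmp, tmm, ?_, fun hcont => ?_⟩
  · have hne : (Icc 0 ε₂).Nonempty := nonempty_Icc.2 hε₂.le
    have hG := integrable_symmSum hf x₀ y₀
    have hnear := (((Hmm.add hne Hpp).add hne Hmp).add hne Hpm).tendsto_setIntegral_sineKernel
      hε₁ hε₂ hG (((hmm.add hpp).add hmp).add hpm)
    have hfar := tendsto_setIntegral_far hG hε₁ hε₂
    obtain ⟨⟨a, ha, hLa⟩, b, hb, hLb⟩ := hLC
    have hs1 := tendsto_setIntegral_strip hG hε₁ hε₂ ha hLa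
    -- the second strip is the first one with the two variables and frequencies exchanged
    have hs2 := tendsto_setIntegral_strip (G := fun t s => symmSum f x₀ y₀ s t) hG.swap
      hε₂ hε₁ hb hLb
    have hs2' := hs2.comp (tendsto_snd.prodMk tendsto_fst :
      Tendsto (fun p : ℝ × ℝ => (p.2, p.1)) (atTop ×ˢ atTop) (atTop ×ˢ atTop))
    have htot := ((hnear.add hs1).add (hs2'.add hfar)).const_mul (1 / Real.pi ^ 2)
    have hval : 1 / Real.pi ^ 2 * ((fmm + fpp + fmp + fpm) * (Real.pi / 2) ^ 2 + 0 + (0 + 0)) =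
        (fpp + fpm + fmp + fmm) / 4 := by
      field_simp
      ring
    rw [hval] at htot
    refine ((Complex.continuous_ofReal.tendsto _).comp htot).congr fun p => ?_
    have hswap : ∫ q in Ioi ε₁ ×ˢ Ioc 0 ε₂,
        symmSum f x₀ y₀ q.1 q.2 * (sineKernel p.1 q.1 * sineKernel p.2 q.2) =
        ∫ q in Ioc 0 ε₂ ×ˢ Ioi ε₁,
          symmSum f x₀ y₀ q.2 q.1 * (sineKernel p.2 q.1 * sineKernel p.1 q.2) := by
      rw [Measure.volume_eq_prod, ← setIntegral_prod_swap]
      refine setIntegral_congr_fun (measurableSet_Ioc.prod measurableSet_Ioi) fun q _ => ?_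
      simp only [Prod.fst_swap, Prod.snd_swap]
      ring
    rw [partialInverse_eq_setIntegral_symmSum hf, setIntegral_quadrant_eq_add
      (integrable_mul_sineKernel hG p.1 p.2) hε₁ hε₂, hswap]
    rfl
  · have lim : ∀ {F F' : Filter ℝ} [F.NeBot] [F'.NeBot] {l : ℝ}, F ≤ 𝓝 x₀ → F' ≤ 𝓝 y₀ →
        Tendsto f (F ×ˢ F') (𝓝 l) → l = f (x₀, y₀) := fun hF hF' hl =>
      tendsto_nhds_unique hl (hcont.mono_left
        ((Filter.prod_mono hF hF').trans_eq nhds_prod_eq.symm))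
    rw [lim nhdsWithin_le_nhds nhdsWithin_le_nhds tpp,
      lim nhdsWithin_le_nhds nhdsWithin_le_nhds tpm,
      lim nhdsWithin_le_nhds nhdsWithin_le_nhds tmp,
      lim nhdsWithin_le_nhds nhdsWithin_le_nhds tmm]
    ring
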